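/- Let $H\in(1/2,1)$ and $\alpha>0$ with $\alpha+H>3/2$, and let $\hat\beta>0$, $\hat h\in\mathbb R$. Let $\tau$ be a persistent renewal process with $\mathbb P(\tau_1=n)=L(n)/n^{1+\alpha}$ for $n\ge1$, where $L:(0,\infty)\to(0,\infty)$ is slowly varying at infinity. Let $W$ be the isonormal Gaussian process (Gaussian noise) on $[0,1]$ with covariance $$\mathbb E[W(f)W(g)]=\int_0^1\!\!\int_0^1 f(s)g(t)\,K(s-t)\,ds\,dt,\qquad K(x)=|x|^{2H-2}.$$ Let $\phi_n$ be the symmetric function on $[0,1]^n$ given, for $0=t_0<t_1<\cdots<t_n<1$, by $$\phi_n(t_1,\dots,t_n)=\begin{cases}\prod_{i=1}^n C_\alpha\,(t_i-t_{i-1})^{\alpha-1}, & \alpha<1,\quad C_\alpha=\alpha\sin(\pi\alpha)/\pi,\\ \mathbb E[\tau_1]^{-n}, & \mathbb E[\tau_1]<\infty,\\ 1, & \alpha=1,\ \mathbb E[\tau_1]=\infty,\end{cases}$$ and for $m,k\ge 0$ put $\psi_{m,k}(t_1,\dots,t_m)=\int_{[0,1]^k}\phi_{m+k}(t_1,\dots,t_{m+k})\,dt_{m+1}\cdots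 dt_{m+k}$. For a measurable symmetric $f$ on $[0,1]^n$ set $$\operatorname{Tr}^j f(u)=\int_{[0,1]^{2j}}f(s_1,\dots,s_{2j},u)\prod_{i=1}^jK(s_{2i}-s_{2i-1})\,ds,\qquad \|g\|^2_{|\mathcal H|^{\otimes r}}=\int_{[0,1]^{2r}}|g(s)g(t)|\prod_{i=1}^rK(s_i-t_i)\,ds\,dt,$$ $$|||f|||_n^2=\sum_{j=0}^{\lfloor n/2\rfloor}\frac{1}{(n-2j)!}\Big(\frac{n!}{j!\,2^j}\Big)^2\big\|\operatorname{Tr}^j|f|\big\|^2_{|\mathcal H|^{\otimes(n-2j)}}.$$ The $n$-th multiple Stratonovich integral is defined by $\mathbb I_n(g^{\otimes n})=W(g)^n$ for measurable $g$ with $\|g\|_{|\mathcal H|}<\infty$, by linearity, and by limits: $\mathbb I_n(f)$ is the $L^2$-limit of $\mathbb I_n(f_j)$ for finite linear combinations $f_j$ of powers $g^{\otimes n}$ with $|||f_j-f|||_n\to0$. Then, for all $m,k\ge 0$, $\mathbb I_m(\psi_{m,k})$ is well defined (it exists and is unique in $L^2$), and the continuum partition function $$Z_{\hat\beta,\hat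 h}=\sum_{m=0}^\infty\sum_{k=0}^\infty\frac{\hat\beta^m\hat h^k}{m!\,k!}\,\mathbb I_m(\psi_{m,k})$$ converges in $L^2$: the double series over $(m,k)$ converges unconditionally to an element of $L^2$. -/

import Mathlib

open MeasureTheory ProbabilityTheory Filter Topology
open scoped ENNReal NNReal Nat

namespace Pinning

noncomputable section

/-! ### The renewal data -/

/-- `L : (0,∞) → (0,∞)` is slowly varying at infinity. -/
def IsSlowlyVarying (L : ℝ → ℝ) : Prop :=
  (∀ t, 0 < t → 0 < L t) ∧
    ∀ a, 0 < a → Tendsto (fun t => L (a * t) / L t) atTop (𝓝 1)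

/-- `p` is the inter-arrival law of a persistent renewal process:
`p n = P(τ₁ = n) = L n / n ^ (1 + α)` for `n ≥ 1`. (Persistence, `P(τ₁ < ∞) = 1`, is the fact
that `p` is a probability mass function on `ℕ` with no mass at `0`.) -/
structure IsInterArrivalLaw (α : ℝ) (L : ℝ → ℝ) (p : PMF ℕ) : Prop where
  slowlyVarying : IsSlowlyVarying L
  zero : p 0 = 0
  apply : ∀ n : ℕ, 1 ≤ n → p n = ENNReal.ofReal (L n / (n : ℝ) ^ (1 + α))

/-- The mean inter-arrival time `E[τ₁] ∈ [0,∞]`. -/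
def meanInterArrival (p : PMF ℕ) : ℝ≥0∞ := ∑' n : ℕ, (n : ℝ≥0∞) * p n

/-- The renewal constant `C_α = α sin(πα) / π`. -/
def renewalConst (α : ℝ) : ℝ := α * Real.sin (Real.pi * α) / Real.pi

/-- The unit cube `[0,1]^n`. -/
def unitCube (n : ℕ) : Set (Fin n → ℝ) := Set.Icc 0 1

/-- For `0 < s₁ < ⋯ < s_k < 1`, the product `∏ i, (s_i - s_{i-1}) ^ (α - 1)` with `s₀ = 0`. -/
def gapProduct (α : ℝ) {k : ℕ} (s : Fin k → ℝ) : ℝ :=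
  ∏ i : Fin k, (s i - (Fin.cons 0 s : Fin (k + 1) → ℝ) i.castSucc) ^ (α - 1)

/-- The symmetric function `φ_k` on `[0,1]^k`; `μ` is the mean inter-arrival time. It is given by
its values on increasing tuples and extended symmetrically, by sorting the tuple. -/
def phi (α : ℝ) (μ : ℝ≥0∞) (k : ℕ) (t : Fin k → ℝ) : ℝ :=
  if α < 1 then renewalConst α ^ k * gapProduct α (t ∘ Tuple.sort t)
  else if μ < ∞ then (1 / μ.toReal) ^ k
  else 1

/-- `ψ_{m,k}(t₁,…,t_m) = ∫_{[0,1]^k} φ_{m+k}(t₁,…,t_{m+k}) dt_{m+1} ⋯ dt_{m+k}`. Where `φ` is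
constant (the cases `α ≥ 1`) this is the same constant. -/
def psi (α : ℝ) (μ : ℝ≥0∞) (m k : ℕ) (t : Fin m → ℝ) : ℝ :=
  ∫ s in unitCube k, phi α μ (m + k) (Fin.append t s)

/-! ### The Gaussian noise -/

/-- The covariance kernel `K(x) = |x| ^ (2H - 2)`. -/
def kern (H x : ℝ) : ℝ := |x| ^ (2 * H - 2)

/-- `⟨f, g⟩_ℋ = ∫₀¹ ∫₀¹ f(s) g(t) K(s - t) ds dt`. -/
def innerH (H : ℝ) (f g : ℝ → ℝ) : ℝ :=
  ∫ s in Set.Icc (0 : ℝ) 1, ∫ t in Set.Icc (0 : ℝ) 1, f s * g t * kern H (s - t)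

/-- For `f ≥ 0` on `[0,1]^n`, the squared norm of `f` in `|ℋ|^{⊗ n}`:
`∫∫ f(s) f(t) ∏ i, K(s_i - t_i) ds dt`. -/
def tensorNormSq (H : ℝ) (n : ℕ) (f : (Fin n → ℝ) → ℝ≥0∞) : ℝ≥0∞ :=
  ∫⁻ s in unitCube n, ∫⁻ t in unitCube n,
    f s * f t * ∏ i, ENNReal.ofReal (kern H (s i - t i))

/-- The space `|ℋ|`: measurable functions `f` with
`∫₀¹ ∫₀¹ |f(s) f(t)| |s - t| ^ (2H - 2) ds dt < ∞` (values off `[0,1]` play no role). -/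
def AbsH (H : ℝ) : Type :=
  {f : ℝ → ℝ // Measurable f ∧
    ∫⁻ s in Set.Icc (0 : ℝ) 1, ∫⁻ t in Set.Icc (0 : ℝ) 1,
      ‖f s‖ₑ * ‖f t‖ₑ * ENNReal.ofReal (kern H (s - t)) < ∞}

/-- `W` is the isonormal Gaussian process of the noise with covariance `K`: a centred Gaussian
family with `E[W(f) W(g)] = ⟨f, g⟩_ℋ`. It is indexed by `|ℋ|`, which is dense in `ℋ`. -/
structure IsIsonormal {Ω : Type*} [MeasurableSpace Ω] (P : Measure Ω) (H : ℝ)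
    (W : AbsH H → Ω → ℝ) : Prop where
  gaussian : IsGaussianProcess W P
  centred : ∀ f, ∫ ω, W f ω ∂P = 0
  covariance : ∀ f g, ∫ ω, W f ω * W g ω ∂P = innerH H f.1 g.1

/-! ### Multiple Stratonovich integrals -/

/-- The `k`-th order trace of a function `f ≥ 0` of `n` variables:
`Tr^k f(u) = ∫_{[0,1]^{2k}} f(s₁,…,s_{2k},u₁,…,u_{n-2k}) ∏_{i ≤ k} K(s_{2i} - s_{2i-1}) ds`. -/
def trace (H : ℝ) (n k : ℕ) (f : (Fin n → ℝ) → ℝ≥0∞) (u : Fin (n - 2 * k) → ℝ) : ℝ≥0∞ :=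
  ∫⁻ s in unitCube (2 * k),
    f (fun i : Fin n => if h : i.1 < 2 * k then s ⟨i.1, h⟩ else u ⟨i.1 - 2 * k, by omega⟩) *
      ∏ i : Fin k, ENNReal.ofReal
        (kern H (s ⟨2 * i.1 + 1, by omega⟩ - s ⟨2 * i.1, by omega⟩))

/-- The squared norm
`∑_{k ≤ n/2} (n! / (k! 2^k))² / (n - 2k)! * ‖Tr^k |f|‖²_{|ℋ|^{⊗ (n-2k)}}`
on symmetric functions of `n` variables, which controls the second moment of the multiple
Stratonovich integral. For `f ≥ 0` it is equal to that second moment. -/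
def stratNormSq (H : ℝ) (n : ℕ) (f : (Fin n → ℝ) → ℝ) : ℝ≥0∞ :=
  ∑ k ∈ Finset.range (n / 2 + 1),
    ((n ! : ℝ≥0∞) / ((k ! : ℝ≥0∞) * 2 ^ k)) ^ 2 / ((n - 2 * k)! : ℝ≥0∞) *
      tensorNormSq H (n - 2 * k) (trace H n k (fun t => ‖f t‖ₑ))

/-- The function `∑ a_g g^{⊗ n}`, for the finite family of coefficients `a = c`. -/
def tensorSum {H : ℝ} (n : ℕ) (c : AbsH H →₀ ℝ) (t : Fin n → ℝ) : ℝ :=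
  c.sum fun g a => a * ∏ i, g.1 (t i)

/-- The multiple Stratonovich integral `∑ a_g W(g)^n` of `∑ a_g g^{⊗ n}`. -/
def stratSum {Ω : Type*} {H : ℝ} (W : AbsH H → Ω → ℝ) (n : ℕ) (c : AbsH H →₀ ℝ) (ω : Ω) : ℝ :=
  c.sum fun g a => a * W g ω ^ n

/-- `F` is the `n`-th multiple Stratonovich integral of the (symmetric) function `f`: the integral
of `g^{⊗ n}` is `W(g)^n`, it is linear, and it extends by limits: `F` is the `L²`-limit of the
integrals of finite sums of powers `g^{⊗ n}` that converge to `f`. -/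
def IsStratonovich {Ω : Type*} [MeasurableSpace Ω] (P : Measure Ω) {H : ℝ}
    (W : AbsH H → Ω → ℝ) (n : ℕ) (f : (Fin n → ℝ) → ℝ) (F : Lp ℝ 2 P) : Prop :=
  AEMeasurable f (volume.restrict (unitCube n)) ∧
    ∃ c : ℕ → AbsH H →₀ ℝ,
      Tendsto (fun j => stratNormSq H n (fun t => f t - tensorSum n (c j) t)) atTop (𝓝 0) ∧
      Tendsto (fun j => eLpNorm (fun ω => F ω - stratSum W n (c j) ω) 2 P) atTop (𝓝 0)

open Classical in
/-- The multiple Stratonovich integral `𝕀_n(f)` as an element of `L²` (and `0` if there is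
none). -/
def stratonovich {Ω : Type*} [MeasurableSpace Ω] (P : Measure Ω) {H : ℝ}
    (W : AbsH H → Ω → ℝ) (n : ℕ) (f : (Fin n → ℝ) → ℝ) : Lp ℝ 2 P :=
  if h : ∃ F : Lp ℝ 2 P, IsStratonovich P W n f F then h.choose else 0

end

end Pinning

/-! The proof has two halves: the norm `stratNormSq` controls the second moment of the multiple
Stratonovich integral, and the norm of `psi` is small compared with the factorials in the series.

Size. Each term of the norm is an integral of `f ⊗ f` against kernels attached to disjoint pairs of
the `2n` variables (`tensorNormSq_trace`). For `psi`, the integrated variables are restored as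
unpaired points, so it is enough to integrate `φ_n ⊗ φ_n` with `n = m + k` and `m` pairs. Sort the
`2n` points of both copies together. A gap inside one copy is at least the merged gap on the left of
the same point, and the distance in a pair is at least the merged left gap of its larger point. With
`a = min α 1`, all exponents involved are nonpositive, so the integrand is bounded by a product of
functions of single merged gaps. The gaps sum to at most `1`; inserting `1 ≤ e^c ∏ e^{-c d_i}`
permits integration over the whole space, where the product factorises, and rescaling by `c ≈ 2n`
yields a negative power of `c`. With the `(2n)!` orderings this gives `(m! k!)² e (B c^{-ε})^{2n}`,
where `ε = a + H - 3/2 > 0` (`lintegral_phi_mul_le`, `exists_stratNormSq_psi_le`). After division by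
`m! k!`, the terms of the series decay faster than any geometric sequence in `n`.

Integrals. The mixed moments `E[X^n Y^n]` of a centred Gaussian pair have exactly the coefficients
of the norm, whence the bound `eLpNorm_stratSum_sq_le`. The kernel is a mixture of products `u_z(s)
u_z(t)` (`factorConst_mul_kern`), so the squared norm obeys a quasi-triangle inequality. Truncation,
Hölder's inequality and Stone–Weierstrass on increasing tuples make finite sums of powers dense
(`exists_stratNormSq_sub_tensorSum_lt`). Existence then follows from completeness of `L²`, and
uniqueness from the same moment bound. -/

namespace Pinning

/-! ### Lebesgue measure on the unit cube -/

/-- Lebesgue measure on `[0,1]`. -/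
noncomputable abbrev unitMeasure : Measure ℝ := volume.restrict (Set.Icc 0 1)

/-- Lebesgue measure on the cube `[0,1]^ι`. -/
noncomputable abbrev cubeMeasure (ι : Type*) [Fintype ι] : Measure (ι → ℝ) :=
  Measure.pi fun _ => unitMeasure

instance : IsProbabilityMeasure unitMeasure := ⟨by simp⟩

variable {ι κ τ : Type*} [Fintype ι] [Fintype κ] [Fintype τ]

lemma restrict_Icc_eq_cubeMeasure :
    (volume : Measure (ι → ℝ)).restrict (Set.Icc 0 1) = cubeMeasure ι := by
  rw [cubeMeasure, ← Measure.restrict_pi_pi, Set.pi_univ_Icc]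
  rfl

lemma restrict_unitCube (n : ℕ) :
    (volume : Measure (Fin n → ℝ)).restrict (unitCube n) = cubeMeasure (Fin n) :=
  restrict_Icc_eq_cubeMeasure

lemma lintegral_pi_reindex (μ : Measure ℝ) [SigmaFinite μ] (e : ι ≃ τ) (F : (τ → ℝ) → ℝ≥0∞) :
    ∫⁻ w, F w ∂(Measure.pi fun _ => μ) = ∫⁻ x, F (x ∘ e.symm) ∂(Measure.pi fun _ => μ) := by
  have h := measurePreserving_piCongrLeft (α := fun _ : τ => ℝ) (fun _ => μ) e
  rw [h.lintegral_map_equiv]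
  refine lintegral_congr fun x => ?_
  congr 1
  ext t
  obtain ⟨i, rfl⟩ := e.surjective t
  simp [MeasurableEquiv.coe_piCongrLeft, Equiv.piCongrLeft_apply_apply]

lemma lintegral_pi_sum (μ : Measure ℝ) [SigmaFinite μ] (F : (ι ⊕ κ → ℝ) → ℝ≥0∞)
    (hF : Measurable F) :
    ∫⁻ w, F w ∂(Measure.pi fun _ => μ) =
      ∫⁻ x, ∫⁻ y, F (Sum.elim x y) ∂(Measure.pi fun _ => μ) ∂(Measure.pi fun _ => μ) := by
  have h := measurePreserving_sumPiEquivProdPi_symm (X := fun _ : ι ⊕ κ => ℝ) (fun _ => μ)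
  have hc : ∀ x : (ι → ℝ) × (κ → ℝ),
      (MeasurableEquiv.sumPiEquivProdPi fun _ : ι ⊕ κ => ℝ).symm x = Sum.elim x.1 x.2 := by
    intro x
    ext (i | i) <;> simp [MeasurableEquiv.coe_sumPiEquivProdPi_symm]
  rw [h.lintegral_map_equiv, lintegral_prod]
  · simp only [hc]
  · exact (hF.comp (MeasurableEquiv.measurable _)).aemeasurable

lemma lintegral_pi_split (μ : Measure ℝ) [SigmaFinite μ] (e : ι ⊕ κ ≃ τ) (F : (τ → ℝ) → ℝ≥0∞)
    (hF : Measurable F) :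
    ∫⁻ w, F w ∂(Measure.pi fun _ => μ) =
      ∫⁻ x, ∫⁻ y, F (Sum.elim x y ∘ e.symm) ∂(Measure.pi fun _ => μ)
        ∂(Measure.pi fun _ => μ) := by
  rw [lintegral_pi_reindex μ e, lintegral_pi_sum]
  exact hF.comp (by fun_prop)

lemma lintegral_append (m k : ℕ) (F : (Fin (m + k) → ℝ) → ℝ≥0∞) (hF : Measurable F) :
    ∫⁻ w, F w ∂(cubeMeasure (Fin (m + k))) =
      ∫⁻ x, ∫⁻ y, F (Fin.append x y) ∂(cubeMeasure (Fin k)) ∂(cubeMeasure (Fin m)) := by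
  rw [lintegral_pi_split _ finSumFinEquiv F hF]
  refine lintegral_congr fun x => lintegral_congr fun y => ?_
  congr 1
  ext t
  refine Fin.addCases (fun i => ?_) (fun i => ?_) t <;> simp

lemma lintegral_fin_prod {n : ℕ} {E : Fin n → Type*} {mE : ∀ i, MeasurableSpace (E i)}
    {μ : (i : Fin n) → Measure (E i)} [∀ i, SigmaFinite (μ i)]
    {f : (i : Fin n) → E i → ℝ≥0∞} (hf : ∀ i, Measurable (f i)) :
    ∫⁻ x, ∏ i, f i (x i) ∂(Measure.pi μ) = ∏ i, ∫⁻ x, f i x ∂μ i := by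
  induction n with
  | zero => simp
  | succ n ih =>
    rw [((measurePreserving_piFinSuccAbove μ 0).symm).lintegral_map_equiv]
    simp_rw [MeasurableEquiv.piFinSuccAbove_symm_apply, Fin.insertNthEquiv,
      Fin.prod_univ_succ, Fin.insertNth_zero]
    change ∫⁻ a : E 0 × ((j : Fin n) → E j.succ), f 0 a.1 * ∏ x, f x.succ (a.2 x)
      ∂((μ 0).prod (Measure.pi fun j => μ j.succ)) = _
    rw [lintegral_prod_mul (f := f 0)
      (g := fun x : (j : Fin n) → E (Fin.succ j) => ∏ j, f (Fin.succ j) (x j))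
      (hf 0).aemeasurable, ih fun i => hf _]
    exact (Finset.measurable_prod _ fun i _ =>
      (hf _).comp (measurable_pi_apply i)).aemeasurable

lemma lintegral_fintype_prod {E : ι → Type*} {mE : ∀ i, MeasurableSpace (E i)}
    {μ : (i : ι) → Measure (E i)} [∀ i, SigmaFinite (μ i)]
    {f : (i : ι) → E i → ℝ≥0∞} (hf : ∀ i, Measurable (f i)) :
    ∫⁻ x, ∏ i, f i (x i) ∂(Measure.pi μ) = ∏ i, ∫⁻ x, f i x ∂μ i := by
  let e := (Fintype.equivFin ι).symm
  rw [(measurePreserving_piCongrLeft μ e).lintegral_map_equiv]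
  simp_rw [← e.prod_comp, MeasurableEquiv.coe_piCongrLeft, Equiv.piCongrLeft_apply_apply]
  exact lintegral_fin_prod fun i => hf _

lemma measurable_finCons {X : Type*} [MeasurableSpace X] {n : ℕ} {f : X → ℝ} {g : X → Fin n → ℝ}
    (hf : Measurable f) (hg : Measurable g) :
    Measurable fun p => (Fin.cons (f p) (g p) : Fin (n + 1) → ℝ) := by
  refine measurable_pi_lambda _ fun l => ?_
  refine Fin.cases ?_ (fun i => ?_) l
  · simpa using hf
  · simpa using hg.eval

/-- Passing from points to successive gaps preserves Lebesgue measure. The base point `x` is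
arbitrary because, once the first point is fixed, it becomes the base point of the remaining ones.
-/
lemma lintegral_prod_gaps (g : ℝ → ℝ≥0∞) (hg : Measurable g) (n : ℕ) (x : ℝ) :
    ∫⁻ v : Fin n → ℝ, ∏ l, g (v l - (Fin.cons x v : Fin (n + 1) → ℝ) l.castSucc) =
      (∫⁻ y, g y) ^ n := by
  induction n generalizing x with
  | zero => simp [volume_pi]
  | succ n ih =>
    have h := (volume_preserving_piFinSuccAbove (fun _ : Fin (n + 1) => ℝ) 0).symm
    rw [h.lintegral_map_equiv]
    have hc : ∀ p : ℝ × (Fin n → ℝ),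
        (MeasurableEquiv.piFinSuccAbove (fun _ : Fin (n + 1) => ℝ) 0).symm p =
          Fin.cons p.1 p.2 := by
      intro p
      simp [MeasurableEquiv.piFinSuccAbove_symm_apply, Fin.insertNthEquiv]
    simp only [hc]
    have hm : Measurable fun p : ℝ × (Fin n → ℝ) =>
        ∏ l, g ((Fin.cons p.1 p.2 : Fin (n + 1) → ℝ) l -
          (Fin.cons x (Fin.cons p.1 p.2 : Fin (n + 1) → ℝ) : Fin (n + 2) → ℝ) l.castSucc) := by
      have hk := measurable_finCons (n := n) measurable_fst (measurable_snd (α := ℝ))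
      exact Finset.measurable_prod _ fun l _ => hg.comp
        (((measurable_pi_apply l).comp hk).sub
          ((measurable_pi_apply _).comp (measurable_finCons measurable_const hk)))
    change ∫⁻ p : ℝ × (Fin n → ℝ), _ ∂((volume : Measure ℝ).prod volume) = _
    rw [lintegral_prod _ hm.aemeasurable]
    have hin : ∀ y : ℝ, ∫⁻ v : Fin n → ℝ,
        ∏ l, g ((Fin.cons y v : Fin (n + 1) → ℝ) l -
          (Fin.cons x (Fin.cons y v : Fin (n + 1) → ℝ) : Fin (n + 2) → ℝ) l.castSucc) =
        g (y - x) * (∫⁻ y, g y) ^ n := by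
      intro y
      simp only [Fin.prod_univ_succ, Fin.cons_zero, Fin.castSucc_zero, Fin.cons_succ,
        Fin.castSucc_succ]
      rw [lintegral_const_mul, ih y]
      exact Finset.measurable_prod _ fun l _ => hg.comp ((measurable_pi_apply l).sub
        ((measurable_pi_apply _).comp (measurable_finCons measurable_const measurable_id)))
    simp only [hin]
    rw [lintegral_mul_const (f := fun y => g (y - x)) _ (by fun_prop), pow_succ',
      lintegral_sub_right_eq_self g x]

lemma sum_gaps (n : ℕ) (v : Fin (n + 1) → ℝ) :
    ∑ l, (v l - (Fin.cons 0 v : Fin (n + 2) → ℝ) l.castSucc) = v (Fin.last n) := by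
  have h1 := Fin.sum_univ_succ (Fin.cons 0 v : Fin (n + 2) → ℝ)
  have h2 := Fin.sum_univ_castSucc (Fin.cons 0 v : Fin (n + 2) → ℝ)
  simp only [Fin.cons_zero, Fin.cons_succ, ← Fin.succ_last] at h1 h2
  rw [Finset.sum_sub_distrib]
  linarith

lemma ae_injective_cubeMeasure :
    ∀ᵐ z ∂(cubeMeasure ι), Function.Injective z := by
  classical
  have h : ∀ i j : ι, i ≠ j → ∀ᵐ z : ι → ℝ, z i ≠ z j := by
    intro i j hij
    have := Measure.addHaar_submodule (volume : Measure (ι → ℝ))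
      (LinearMap.ker ((LinearMap.proj i : (ι → ℝ) →ₗ[ℝ] ℝ) - LinearMap.proj j)) ?_
    · rw [ae_iff]
      refine measure_mono_null (fun z hz => ?_) this
      simpa [sub_eq_zero] using hz
    · intro htop
      have : Pi.single (M := fun _ => ℝ) i (1 : ℝ) ∈
          LinearMap.ker ((LinearMap.proj i : (ι → ℝ) →ₗ[ℝ] ℝ) - LinearMap.proj j) := by
        rw [htop]; trivial
      simp [hij] at this
  have h' : ∀ᵐ z : ι → ℝ, ∀ i j : ι, i ≠ j → z i ≠ z j := by
    rw [ae_all_iff]; intro i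
    rw [ae_all_iff]; intro j
    by_cases hij : i = j
    · simp [hij]
    · filter_upwards [h i j hij] with z hz _ using hz
  rw [← restrict_Icc_eq_cubeMeasure]
  filter_upwards [ae_restrict_of_ae h'] with z hz i j hij
  by_contra hne
  exact hz i j hne hij

lemma ae_mem_Ioc_cubeMeasure :
    ∀ᵐ z ∂(cubeMeasure ι), ∀ i, 0 < z i ∧ z i ≤ 1 := by
  have h1 : ∀ᵐ z ∂(cubeMeasure ι), ∀ i, z i ≠ 0 := by
    rw [ae_all_iff]; intro i
    exact Measure.ae_eval_ne _ i 0
  have h2 : ∀ᵐ z ∂(cubeMeasure ι), z ∈ Set.Icc (0 : ι → ℝ) 1 := by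
    rw [← restrict_Icc_eq_cubeMeasure]
    exact ae_restrict_mem measurableSet_Icc
  filter_upwards [h1, h2] with z hz hz' i
  exact ⟨lt_of_le_of_ne (hz'.1 i) (hz i).symm, hz'.2 i⟩

/-! ### Iterated integrals as integrals against a product of paired kernels -/

@[fun_prop]
lemma measurable_kern (H : ℝ) : Measurable (kern H) := by
  unfold kern
  exact (measurable_norm (α := ℝ)).pow_const _

/-- The product of the covariance kernels over a family of pairs of points. -/
noncomputable def pairKernel {ι σ : Type*} [Fintype ι] (H : ℝ) (e : ι ⊕ ι → σ) (z : σ → ℝ) : ℝ :=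
  ∏ p, kern H (z (e (.inl p)) - z (e (.inr p)))

lemma kern_nonneg (H x : ℝ) : 0 ≤ kern H x := Real.rpow_nonneg (abs_nonneg x) _

section pairKernel

variable {ι σ : Type*} [Fintype ι] (H : ℝ) (e : ι ⊕ ι → σ)

lemma pairKernel_nonneg (z : σ → ℝ) : 0 ≤ pairKernel H e z :=
  Finset.prod_nonneg fun _ _ => kern_nonneg _ _

@[fun_prop]
lemma measurable_pairKernel : Measurable (pairKernel H e) := by
  unfold pairKernel
  fun_prop

lemma ofReal_pairKernel (z : σ → ℝ) : ENNReal.ofReal (pairKernel H e z) =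
    ∏ p, ENNReal.ofReal (kern H (z (e (.inl p)) - z (e (.inr p)))) :=
  ENNReal.ofReal_prod_of_nonneg fun _ _ => kern_nonneg _ _

end pairKernel

/-- The pairing of the `2 n` variables of `f ⊗ f` in the `j`-th term of the norm: the first `2 j`
variables of each copy of `f` are paired with each other, the others with those of the other
copy. -/
def pairFun (n j : ℕ) (hj : 2 * j ≤ n) :
    (Fin j ⊕ Fin j ⊕ Fin (n - 2 * j)) ⊕ (Fin j ⊕ Fin j ⊕ Fin (n - 2 * j)) → Fin n ⊕ Fin n
  | .inl (.inl i) => .inl ⟨2 * i.1 + 1, by omega⟩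
  | .inl (.inr (.inl i)) => .inr ⟨2 * i.1 + 1, by omega⟩
  | .inl (.inr (.inr i)) => .inl ⟨2 * j + i.1, by omega⟩
  | .inr (.inl i) => .inl ⟨2 * i.1, by omega⟩
  | .inr (.inr (.inl i)) => .inr ⟨2 * i.1, by omega⟩
  | .inr (.inr (.inr i)) => .inr ⟨2 * j + i.1, by omega⟩

lemma pairFun_bijective (n j : ℕ) (hj : 2 * j ≤ n) : Function.Bijective (pairFun n j hj) := by
  rw [Fintype.bijective_iff_injective_and_card]
  constructor
  · rintro ((a | a | a) | (a | a | a)) ((b | b | b) | (b | b | b)) h <;>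
      simp only [pairFun, Sum.inl.injEq, Sum.inr.injEq, reduceCtorEq, Fin.mk.injEq] at h ⊢ <;>
      first | (ext; omega) | omega
  · simp only [Fintype.card_sum, Fintype.card_fin]
    omega

/-- The pairing `pairFun` as an equivalence. -/
noncomputable def pairEquiv (n j : ℕ) (hj : 2 * j ≤ n) :
    (Fin j ⊕ Fin j ⊕ Fin (n - 2 * j)) ⊕ (Fin j ⊕ Fin j ⊕ Fin (n - 2 * j)) ≃ Fin n ⊕ Fin n :=
  Equiv.ofBijective _ (pairFun_bijective n j hj)

/-- The variables of a function of `n` variables, with the last ones first. -/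
def joinEquiv (n j : ℕ) (hj : 2 * j ≤ n) : Fin (n - 2 * j) ⊕ Fin (2 * j) ≃ Fin n :=
  (Equiv.sumComm _ _).trans (finSumFinEquiv.trans (finCongr (by omega)))

lemma elim_comp_joinEquiv_symm (n j : ℕ) (hj : 2 * j ≤ n) (u : Fin (n - 2 * j) → ℝ)
    (s : Fin (2 * j) → ℝ) : Sum.elim u s ∘ (joinEquiv n j hj).symm =
      fun i : Fin n => if h : i.1 < 2 * j then s ⟨i.1, h⟩ else u ⟨i.1 - 2 * j, by omega⟩ := by
  rw [← Equiv.eq_comp_symm, Equiv.symm_symm]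
  ext (i | i)
  · simp [joinEquiv]
  · simp [joinEquiv]

/-- Two applications of Tonelli's theorem pull the inner integrals out. This serves both for traces,
where `y` runs over the variables paired inside a copy, and for `psi`, where it runs over the
integrated variables. -/
lemma lintegral_two_copies {X Y : Type*} [MeasurableSpace X] [MeasurableSpace Y] {μ : Measure X}
    {ν : Measure Y} [SFinite μ] [SFinite ν] {A : X → Y → ℝ≥0∞} {K : X → X → ℝ≥0∞}
    (hA : Measurable (Function.uncurry A)) (hK : Measurable (Function.uncurry K)) :
    ∫⁻ x, ∫⁻ x', (∫⁻ y, A x y ∂ν) * (∫⁻ y, A x' y ∂ν) * K x x' ∂μ ∂μ =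
      ∫⁻ x, ∫⁻ y, ∫⁻ x', ∫⁻ y', A x y * (A x' y' * K x x') ∂ν ∂μ ∂ν ∂μ := by
  have hAu : ∀ u, Measurable (A u) := fun u => hA.comp measurable_prodMk_left
  have hKu : ∀ u, Measurable (K u) := fun u => hK.comp measurable_prodMk_left
  have hT : Measurable fun x => ∫⁻ y, A x y ∂ν := hA.lintegral_prod_right'
  refine lintegral_congr fun x => ?_
  have hTK : Measurable fun x' => (∫⁻ y, A x' y ∂ν) * K x x' := hT.mul (hKu x)
  have hin : ∀ y, ∫⁻ x', ∫⁻ y', A x y * (A x' y' * K x x') ∂ν ∂μ =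
      A x y * ∫⁻ x', (∫⁻ y, A x' y ∂ν) * K x x' ∂μ := by
    intro y
    rw [← lintegral_const_mul _ hTK]
    refine lintegral_congr fun x' => ?_
    rw [lintegral_const_mul _ ((hAu x').mul_const _), lintegral_mul_const _ (hAu x')]
  simp only [hin, mul_assoc]
  rw [lintegral_mul_const _ (hAu x), lintegral_const_mul _ hTK]

lemma pairKernel_pairEquiv_elim (H : ℝ) (n j : ℕ) (hj : 2 * j ≤ n) (x y : Fin n → ℝ) :
    ENNReal.ofReal (pairKernel H (pairEquiv n j hj) (Sum.elim x y)) =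
      (∏ i : Fin j, ENNReal.ofReal
        (kern H (x ⟨2 * i.1 + 1, by omega⟩ - x ⟨2 * i.1, by omega⟩))) *
      ((∏ i : Fin j, ENNReal.ofReal
        (kern H (y ⟨2 * i.1 + 1, by omega⟩ - y ⟨2 * i.1, by omega⟩))) *
      ∏ i : Fin (n - 2 * j), ENNReal.ofReal
        (kern H (x ⟨2 * j + i.1, by omega⟩ - y ⟨2 * j + i.1, by omega⟩))) := by
  simp only [ofReal_pairKernel, Fintype.prod_sum_type]
  simp only [pairEquiv, Equiv.ofBijective_apply, pairFun, Sum.elim_inl, Sum.elim_inr]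

lemma measurable_elim_comp {σ ι' κ' X : Type*} [MeasurableSpace X] {f : X → ι' → ℝ}
    {g : X → κ' → ℝ} (e : σ → ι' ⊕ κ') (hf : Measurable f) (hg : Measurable g) :
    Measurable fun p => Sum.elim (f p) (g p) ∘ e := by
  refine measurable_pi_lambda _ fun i => ?_
  rcases h : e i with a | a <;> simp only [Function.comp, h, Sum.elim_inl, Sum.elim_inr] <;>
    fun_prop

lemma lintegral_pairKernel (H : ℝ) (n : ℕ) (e : ι ⊕ ι → Fin n ⊕ Fin n) (f : (Fin n → ℝ) → ℝ≥0∞)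
    (hf : Measurable f) :
    ∫⁻ z, f (z ∘ Sum.inl) * f (z ∘ Sum.inr) *
        ENNReal.ofReal (pairKernel H e z) ∂(cubeMeasure (Fin n ⊕ Fin n)) =
      ∫⁻ x, ∫⁻ y, f x * f y * ENNReal.ofReal (pairKernel H e (Sum.elim x y))
        ∂(cubeMeasure (Fin n)) ∂(cubeMeasure (Fin n)) := by
  rw [lintegral_pi_sum]
  · simp only [Sum.elim_comp_inl, Sum.elim_comp_inr]
  · refine .mul (.mul (hf.comp ?_) (hf.comp ?_)) ?_ <;> fun_prop

/-- Unfolding the traces turns every term of the norm into one integral over `2n` points with a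
perfect pairing, so that the different `j` differ only in the pairing and are estimated together. -/
lemma tensorNormSq_trace (H : ℝ) (n j : ℕ) (hj : 2 * j ≤ n) (f : (Fin n → ℝ) → ℝ≥0∞)
    (hf : Measurable f) :
    tensorNormSq H (n - 2 * j) (trace H n j f) =
      ∫⁻ z, f (z ∘ Sum.inl) * f (z ∘ Sum.inr) *
        ENNReal.ofReal (pairKernel H (pairEquiv n j hj) z) ∂(cubeMeasure (Fin n ⊕ Fin n)) := by
  rw [lintegral_pairKernel _ _ _ _ hf]
  let A : (Fin (n - 2 * j) → ℝ) → (Fin (2 * j) → ℝ) → ℝ≥0∞ := fun u s =>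
    f (Sum.elim u s ∘ (joinEquiv n j hj).symm) * ∏ i : Fin j, ENNReal.ofReal
        (kern H (s ⟨2 * i.1 + 1, by omega⟩ - s ⟨2 * i.1, by omega⟩))
  let K : (Fin (n - 2 * j) → ℝ) → (Fin (n - 2 * j) → ℝ) → ℝ≥0∞ := fun u u' =>
    ∏ i, ENNReal.ofReal (kern H (u i - u' i))
  have hAm : Measurable (Function.uncurry A) := by
    refine .mul (hf.comp (measurable_elim_comp _ measurable_fst measurable_snd)) ?_
    fun_prop
  have hKm : Measurable (Function.uncurry K) := by
    unfold K Function.uncurry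
    fun_prop
  have hT : trace H n j f = fun u => ∫⁻ s, A u s ∂(cubeMeasure (Fin (2 * j))) := by
    ext u
    simp only [trace, restrict_unitCube, A, elim_comp_joinEquiv_symm]
  have hF : Measurable fun p : (Fin n → ℝ) × (Fin n → ℝ) =>
      f p.1 * f p.2 * ENNReal.ofReal (pairKernel H (pairEquiv n j hj) (Sum.elim p.1 p.2)) := by
    refine .mul (.mul (hf.comp measurable_fst) (hf.comp measurable_snd)) ?_
    exact ((measurable_pairKernel _ _).comp
      (measurable_elim_comp id measurable_fst measurable_snd)).ennreal_ofReal
  rw [hT, tensorNormSq, restrict_unitCube, lintegral_two_copies hAm hKm,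
    lintegral_pi_split _ (joinEquiv n j hj) _ (Measurable.lintegral_prod_right' hF)]
  refine lintegral_congr fun u => lintegral_congr fun s => ?_
  refine Eq.trans ?_ (lintegral_pi_split _ (joinEquiv n j hj) _
    (hF.comp measurable_prodMk_left)).symm
  refine lintegral_congr fun u' => lintegral_congr fun s' => ?_
  change A u s * (A u' s' * K u u') = f (Sum.elim u s ∘ (joinEquiv n j hj).symm) *
    f (Sum.elim u' s' ∘ (joinEquiv n j hj).symm) * ENNReal.ofReal
      (pairKernel H (pairEquiv n j hj) (Sum.elim (Sum.elim u s ∘ (joinEquiv n j hj).symm)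
        (Sum.elim u' s' ∘ (joinEquiv n j hj).symm)))
  simp only [pairKernel_pairEquiv_elim, A, K, elim_comp_joinEquiv_symm]
  have h1 : ∀ i : Fin j, 2 * i.1 + 1 < 2 * j := fun i => by omega
  have h2 : ∀ i : Fin j, 2 * i.1 < 2 * j := fun i => by omega
  simp only [h1, h2, dite_true, add_lt_iff_neg_left, not_lt_zero, dite_false,
    add_tsub_cancel_left, Fin.eta]
  ring

/-! ### Measurability and symmetry of `φ` and `ψ` -/

/-- The sorting permutation is determined by finitely many comparisons of coordinates: `σ` sorts
`t`, and ties are broken by index. -/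
lemma measurableSet_sort_eq (n : ℕ) (σ : Equiv.Perm (Fin n)) :
    MeasurableSet {t : Fin n → ℝ | Tuple.sort t = σ} := by
  have : {t : Fin n → ℝ | Tuple.sort t = σ} =
      (⋂ i, ⋂ j, ⋂ _ : i ≤ j, {t : Fin n → ℝ | t (σ i) ≤ t (σ j)}) ∩
        ⋂ i, ⋂ j, ⋂ _ : i < j, ⋂ _ : ¬ σ i < σ j, {t : Fin n → ℝ | t (σ i) = t (σ j)}ᶜ := by
    ext t
    simp only [Set.mem_ofPred_eq, eq_comm (a := Tuple.sort t), Tuple.eq_sort_iff, Set.mem_inter_iff,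
      Set.mem_iInter, Set.mem_compl_iff, Monotone, Function.comp]
    refine and_congr Iff.rfl ⟨fun h i j hij hn he => hn (h i j hij he), fun h i j hij he => ?_⟩
    by_contra hn
    exact h i j hij hn he
  rw [this]
  refine .inter (.iInter fun i => .iInter fun j => .iInter fun _ => ?_)
    (.iInter fun i => .iInter fun j => .iInter fun _ => .iInter fun _ => .compl ?_)
  · exact measurableSet_le (measurable_pi_apply _) (measurable_pi_apply _)
  · exact measurableSet_eq_fun (measurable_pi_apply _) (measurable_pi_apply _)

lemma measurable_comp_sort (n : ℕ) : Measurable fun t : Fin n → ℝ => t ∘ Tuple.sort t := by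
  let _ : MeasurableSpace (Equiv.Perm (Fin n)) := ⊤
  have h1 : Measurable fun t : Fin n → ℝ => Tuple.sort t :=
    measurable_to_countable' fun σ => measurableSet_sort_eq n σ
  refine measurable_pi_lambda _ fun i => ?_
  have h2 : Measurable fun p : (Fin n → ℝ) × Equiv.Perm (Fin n) => p.1 (p.2 i) :=
    measurable_from_prod_countable_left fun σ => measurable_pi_apply (σ i)
  exact h2.comp (measurable_id.prodMk h1)

lemma measurable_gapProduct (α : ℝ) (n : ℕ) :
    Measurable fun s : Fin n → ℝ => gapProduct α s := by
  unfold gapProduct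
  refine Finset.measurable_prod _ fun i _ => Measurable.pow_const (.sub ?_ ?_) _
  · exact measurable_pi_apply i
  · exact (measurable_pi_apply _).comp (measurable_finCons measurable_const measurable_id)

lemma measurable_phi (α : ℝ) (μ : ℝ≥0∞) (n : ℕ) : Measurable (phi α μ n) := by
  unfold phi
  split_ifs
  · exact ((measurable_gapProduct α n).comp (measurable_comp_sort n)).const_mul _
  · exact measurable_const
  · exact measurable_const

lemma phi_comp_perm (α : ℝ) (μ : ℝ≥0∞) (n : ℕ) (t : Fin n → ℝ) (σ : Equiv.Perm (Fin n)) :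
    phi α μ n (t ∘ σ) = phi α μ n t := by
  simp only [phi, Tuple.comp_perm_comp_sort_eq_comp_sort]

lemma measurable_append (m k : ℕ) :
    Measurable fun p : (Fin m → ℝ) × (Fin k → ℝ) => Fin.append p.1 p.2 := by
  refine measurable_pi_lambda _ fun i => ?_
  refine Fin.addCases (fun i => ?_) (fun i => ?_) i <;> simp <;> fun_prop

lemma measurable_psi (α : ℝ) (μ : ℝ≥0∞) (m k : ℕ) : Measurable (psi α μ m k) := by
  have h : Measurable fun p : (Fin m → ℝ) × (Fin k → ℝ) =>
    phi α μ (m + k) (Fin.append p.1 p.2) := (measurable_phi _ _ _).comp (measurable_append m k)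
  exact (h.stronglyMeasurable.integral_prod_right').measurable

lemma psi_comp_perm (α : ℝ) (μ : ℝ≥0∞) (m k : ℕ) (t : Fin m → ℝ) (σ : Equiv.Perm (Fin m)) :
    psi α μ m k (t ∘ σ) = psi α μ m k t := by
  unfold psi
  congr 1
  ext s
  rw [← phi_comp_perm α μ (m + k) (Fin.append t s)
    (finSumFinEquiv.permCongr (Equiv.sumCongr σ (Equiv.refl _)))]
  congr 1
  ext i
  refine Fin.addCases (fun i => ?_) (fun i => ?_) i <;> simp

lemma enorm_psi_le (α : ℝ) (μ : ℝ≥0∞) (m k : ℕ) (t : Fin m → ℝ) :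
    ‖psi α μ m k t‖ₑ ≤ ∫⁻ s, ‖phi α μ (m + k) (Fin.append t s)‖ₑ ∂(cubeMeasure (Fin k)) := by
  rw [psi, restrict_unitCube]
  exact enorm_integral_le_lintegral_enorm _

/-! ### Pointwise bounds by the gaps of the merged points -/

/-- The gap to the left of the `l`-th of a family of points, with a point added at `0`. -/
def leftGap {n : ℕ} (v : Fin n → ℝ) (l : Fin n) : ℝ :=
  v l - (Fin.cons 0 v : Fin (n + 1) → ℝ) l.castSucc

lemma leftGap_le_sub {n : ℕ} {v : Fin n → ℝ} (hv : Monotone v) {l l' : Fin n} (h : l' < l) :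
    leftGap v l ≤ v l - v l' := by
  cases n with
  | zero => exact l.elim0
  | succ n =>
    obtain ⟨i, rfl⟩ := Fin.exists_succ_eq.2 (Fin.ne_zero_of_lt h)
    simp only [leftGap, Fin.castSucc_succ, Fin.cons_succ]
    have : v l' ≤ v i.castSucc := hv (Fin.le_castSucc_iff.2 h)
    linarith

lemma leftGap_le {n : ℕ} {v : Fin n → ℝ} (h0 : ∀ l, 0 < v l) (l : Fin n) : leftGap v l ≤ v l := by
  cases n with
  | zero => exact l.elim0
  | succ n =>
    refine Fin.cases ?_ (fun i => ?_) l
    · simp [leftGap]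
    · simp only [leftGap, Fin.castSucc_succ, Fin.cons_succ]
      linarith [h0 i.castSucc]

lemma leftGap_pos {n : ℕ} {v : Fin n → ℝ} (hv : StrictMono v) (h0 : ∀ l, 0 < v l) (l : Fin n) :
    0 < leftGap v l := by
  cases n with
  | zero => exact l.elim0
  | succ n =>
    refine Fin.cases ?_ (fun i => ?_) l
    · simpa [leftGap] using h0 0
    · simp only [leftGap, Fin.castSucc_succ, Fin.cons_succ, sub_pos]
      exact hv (Fin.castSucc_lt_succ)

/-- `d i` is at most the distance from the point `z i` to the points on its left, including `0`. -/
structure IsGapBound {σ : Type*} (z d : σ → ℝ) : Prop where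
  pos : ∀ i, 0 < d i
  le : ∀ i, d i ≤ z i
  le_sub : ∀ i j, z j < z i → d i ≤ z i - z j

lemma IsGapBound.comp {σ ρ : Type*} {z d : σ → ℝ} (h : IsGapBound z d) (f : ρ → σ) :
    IsGapBound (z ∘ f) (d ∘ f) :=
  ⟨fun _ => h.pos _, fun _ => h.le _, fun _ _ => h.le_sub _ _⟩

lemma isGapBound_leftGap {ρ : Type*} {n : ℕ} {z : ρ → ℝ} (σ : Fin n ≃ ρ) (hσ : StrictMono (z ∘ σ))
    (h0 : ∀ i, 0 < z i) : IsGapBound z fun i => leftGap (z ∘ σ) (σ.symm i) where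
  pos _ := leftGap_pos hσ (fun _ => h0 _) _
  le i := by simpa using leftGap_le (v := z ∘ σ) (fun _ => h0 _) (σ.symm i)
  le_sub i j hij := by
    have h : σ.symm j < σ.symm i := hσ.lt_iff_lt.1 (by simpa using hij)
    simpa using leftGap_le_sub hσ.monotone h

/-- Adding further points can only shrink gaps, and the exponent `α - 1` is nonpositive, so
replacing the gaps of `t` by smaller numbers `d` increases the product. -/
lemma gapProduct_nonneg_le {α : ℝ} (hα : α ≤ 1) {n : ℕ} {t d : Fin n → ℝ} (hd : IsGapBound t d)
    (ht : Function.Injective t) :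
    0 ≤ gapProduct α (t ∘ Tuple.sort t) ∧
      gapProduct α (t ∘ Tuple.sort t) ≤ ∏ i, d i ^ (α - 1) := by
  have hs : StrictMono (t ∘ Tuple.sort t) :=
    (Tuple.monotone_sort t).strictMono_of_injective (ht.comp (Equiv.injective _))
  have key : ∀ i, d (Tuple.sort t i) ≤ leftGap (t ∘ Tuple.sort t) i := by
    intro i
    cases n with
    | zero => exact i.elim0
    | succ n =>
      revert i
      refine Fin.cases ?_ (fun i => ?_)
      · simpa [leftGap] using hd.le _
      · simp only [leftGap, Fin.castSucc_succ, Fin.cons_succ]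
        exact hd.le_sub _ _ (hs Fin.castSucc_lt_succ)
  constructor
  · exact Finset.prod_nonneg fun i _ => Real.rpow_nonneg ((hd.pos _).le.trans (key i)) _
  · rw [← Equiv.prod_comp (Tuple.sort t) fun i => d i ^ (α - 1)]
    refine Finset.prod_le_prod (fun i _ => Real.rpow_nonneg ((hd.pos _).le.trans (key i)) _)
      fun i _ => ?_
    exact Real.rpow_le_rpow_of_nonpos (hd.pos _) (key i) (by linarith)

/-- A constant with `|φ_n| ≤ C ^ n ∏ gaps ^ (min α 1 - 1)`. -/
noncomputable def phiConst (α : ℝ) (μ : ℝ≥0∞) : ℝ :=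
  max 1 (max |renewalConst α| |1 / μ.toReal|)

lemma one_le_phiConst (α : ℝ) (μ : ℝ≥0∞) : 1 ≤ phiConst α μ := le_max_left _ _

lemma abs_phi_le (α : ℝ) (μ : ℝ≥0∞) {n : ℕ} {t d : Fin n → ℝ} (hd : IsGapBound t d)
    (ht : Function.Injective t) :
    |phi α μ n t| ≤ phiConst α μ ^ n * ∏ i, d i ^ (min α 1 - 1) := by
  unfold phi
  split_ifs with h1 h2
  · obtain ⟨h3, h4⟩ := gapProduct_nonneg_le h1.le hd ht
    rw [min_eq_left h1.le, abs_mul, abs_pow, abs_of_nonneg h3]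
    gcongr
    · exact pow_nonneg (zero_le_one.trans (one_le_phiConst α μ)) _
    exact (le_max_left |renewalConst α| _).trans (le_max_right (1 : ℝ) _)
  · rw [min_eq_right (not_lt.1 h1), abs_pow]
    simp only [sub_self, Real.rpow_zero, Finset.prod_const_one, mul_one]
    gcongr
    exact (le_max_right _ |1 / μ.toReal|).trans (le_max_right (1 : ℝ) _)
  · rw [min_eq_right (not_lt.1 h1), abs_one]
    simp only [sub_self, Real.rpow_zero, Finset.prod_const_one, mul_one]
    exact one_le_pow₀ (one_le_phiConst α μ)

/-- The larger point of the pair has its gap below the distance, and so pays for the kernel. The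
factors `max 1` make the bound symmetric, without recording which point is larger. As the rescaled
gap `c * d` stands inside the maximum, the price in powers of `c` is paid once per pair rather than
once per point. -/
lemma kern_sub_le {H c : ℝ} (hH : H ≤ 1) (hc : 0 < c) {σ : Type*} {z d : σ → ℝ}
    (hd : IsGapBound z d) {i j : σ} (hij : z i ≠ z j) :
    kern H (z i - z j) ≤ c ^ (2 - 2 * H) *
      (max 1 ((c * d i) ^ (2 * H - 2)) * max 1 ((c * d j) ^ (2 * H - 2))) := by
  wlog h : z j < z i generalizing i j
  · rw [mul_comm (max _ _), show kern H (z i - z j) = kern H (z j - z i) by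
      rw [kern, kern, abs_sub_comm]]
    exact this hij.symm (lt_of_le_of_ne (not_lt.1 h) hij)
  have h1 : kern H (z i - z j) ≤ d i ^ (2 * H - 2) := by
    rw [kern, abs_of_pos (sub_pos.2 h)]
    exact Real.rpow_le_rpow_of_nonpos (hd.pos _) (hd.le_sub _ _ h) (by linarith)
  have h2 : d i ^ (2 * H - 2) = c ^ (2 - 2 * H) * (c * d i) ^ (2 * H - 2) := by
    rw [Real.mul_rpow hc.le (hd.pos i).le, ← mul_assoc, ← Real.rpow_add hc]
    simp
  rw [h2] at h1
  refine h1.trans (mul_le_mul_of_nonneg_left ?_ (by positivity))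
  exact (le_max_right 1 _).trans (le_mul_of_one_le_right (by positivity) (le_max_left _ _))

/-- Injectivity of `e` means that a point lies in at most one pair, so its factor is used at most
once; points in no pair contribute factors that are at least `1`. -/
lemma pairKernel_le {H c : ℝ} (hH : H ≤ 1) (hc : 0 < c) {z d : κ → ℝ}
    (hd : IsGapBound z d) (hz : Function.Injective z) (e : ι ⊕ ι → κ) (he : Function.Injective e) :
    pairKernel H e z ≤ (c ^ (2 - 2 * H)) ^ Fintype.card ι *
      ∏ i, max 1 ((c * d i) ^ (2 * H - 2)) := by
  classical
  calc pairKernel H e z ≤ ∏ p : ι, c ^ (2 - 2 * H) *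
        (max 1 ((c * d (e (.inl p))) ^ (2 * H - 2)) *
          max 1 ((c * d (e (.inr p))) ^ (2 * H - 2))) := by
        refine Finset.prod_le_prod (fun _ _ => kern_nonneg _ _) fun p _ => ?_
        exact kern_sub_le hH hc hd fun h => by simpa using he (hz h)
    _ = (c ^ (2 - 2 * H)) ^ Fintype.card ι * ∏ q : ι ⊕ ι, max 1 ((c * d (e q)) ^ (2 * H - 2)) := by
        rw [Finset.prod_mul_distrib, Finset.prod_mul_distrib, Fintype.prod_sum_type,
          Finset.prod_const, Finset.card_univ]
    _ ≤ _ := by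
        refine mul_le_mul_of_nonneg_left ?_ (by positivity)
        rw [← Finset.prod_image (s := Finset.univ) (g := e)
          (f := fun i => max 1 ((c * d i) ^ (2 * H - 2))) (fun _ _ _ _ h => he h),
          ← Finset.prod_sdiff (Finset.subset_univ (Finset.univ.image e))]
        refine le_mul_of_one_le_left (Finset.prod_nonneg fun _ _ => by positivity) ?_
        exact Finset.prod_induction _ (fun x => (1 : ℝ) ≤ x)
          (fun a b ha hb => one_le_mul_of_one_le_of_one_le ha hb) le_rfl
          fun _ _ => le_max_left _ _

/-! ### The integral of `φ ⊗ φ` against paired kernels -/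

lemma lintegral_comp_const_mul {c : ℝ} (hc : 0 < c) (f : ℝ → ℝ≥0∞) (hf : Measurable f) :
    ∫⁻ x, f (c * x) = ENNReal.ofReal c⁻¹ * ∫⁻ x, f x := by
  have h := Real.map_volume_mul_left hc.ne'
  rw [← lintegral_map hf (measurable_const_mul c), h, lintegral_smul_measure,
    abs_of_pos (inv_pos.2 hc), smul_eq_mul]

/-- The weight carried by a gap. -/
noncomputable def gapWeight (a H x : ℝ) : ℝ := x ^ (a - 1) * max 1 (x ^ (2 * H - 2))

lemma gapWeight_nonneg {a H x : ℝ} (hx : 0 ≤ x) : 0 ≤ gapWeight a H x :=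
  mul_nonneg (Real.rpow_nonneg hx _) (zero_le_one.trans (le_max_left _ _))

/-- The exponentially damped weight of a positive gap. -/
noncomputable def gapDensity (a H : ℝ) : ℝ → ℝ≥0∞ :=
  (Set.Ioi 0).indicator fun x => ENNReal.ofReal (gapWeight a H x * Real.exp (-x))

lemma measurable_gapDensity (a H : ℝ) : Measurable (gapDensity a H) := by
  refine Measurable.indicator ?_ measurableSet_Ioi
  unfold gapWeight
  fun_prop

/-- Bounding the maximum by a sum leaves two Gamma integrals, with parameters `a` and `a + 2H - 2`.
-/
lemma lintegral_gapDensity_lt_top {a H : ℝ} (ha : 0 < a) (haH : 0 < a + 2 * H - 2) :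
    ∫⁻ x, gapDensity a H x < ∞ := by
  rw [gapDensity, lintegral_indicator measurableSet_Ioi]
  have h1 := (Real.GammaIntegral_convergent ha).add (Real.GammaIntegral_convergent haH)
  refine (setLIntegral_mono_ae' measurableSet_Ioi (g := fun x => ENNReal.ofReal
    (Real.exp (-x) * x ^ (a - 1) + Real.exp (-x) * x ^ (a + 2 * H - 2 - 1))) ?_).trans_lt
    h1.lintegral_lt_top
  refine .of_forall fun x hx => ENNReal.ofReal_le_ofReal ?_
  have hx0 : (0 : ℝ) < x := hx
  have h2 : x ^ (a + 2 * H - 2 - 1) = x ^ (a - 1) * x ^ (2 * H - 2) := by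
    rw [← Real.rpow_add hx0]
    ring_nf
  have h3 : max 1 (x ^ (2 * H - 2)) ≤ 1 + x ^ (2 * H - 2) :=
    max_le (by linarith [Real.rpow_nonneg hx0.le (2 * H - 2)]) (by linarith)
  rw [h2, gapWeight]
  calc _ ≤ x ^ (a - 1) * (1 + x ^ (2 * H - 2)) * Real.exp (-x) := by gcongr
    _ = _ := by ring

lemma sum_leftGap_le {n : ℕ} {v : Fin n → ℝ} (h1 : ∀ l, v l ≤ 1) : ∑ l, leftGap v l ≤ 1 := by
  cases n with
  | zero => simp
  | succ n =>
    simp only [leftGap, sum_gaps]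
    exact h1 _

lemma measurable_leftGap {n : ℕ} (l : Fin n) : Measurable fun v : Fin n → ℝ => leftGap v l :=
  (measurable_pi_apply l).sub
    ((measurable_pi_apply _).comp (measurable_finCons measurable_const measurable_id))

/-- The constant of the bound `enorm_phi_mul_le`, with `p` pairs and `n` variables in each copy. -/
noncomputable def gapConst (α : ℝ) (μ : ℝ≥0∞) (H : ℝ) (p n : ℕ) (c : ℝ) : ℝ :=
  phiConst α μ ^ (n + n) * (c ^ (2 - 2 * H)) ^ p * (c ^ (1 - min α 1)) ^ (n + n) * Real.exp c

lemma gapConst_nonneg (α : ℝ) (μ : ℝ≥0∞) (H : ℝ) (p n : ℕ) {c : ℝ} (hc : 0 < c) :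
    0 ≤ gapConst α μ H p n c := by
  have := zero_le_one.trans (one_le_phiConst α μ)
  unfold gapConst
  positivity

/-- The decoupling step: with both copies merged and sorted by `σ`, the integrand is bounded by a
product in which each factor depends on one gap only. -/
lemma abs_phi_mul_le {H c : ℝ} (hH : H ≤ 1) (hc : 0 < c) (α : ℝ) (μ : ℝ≥0∞) {n : ℕ}
    (e : ι ⊕ ι → Fin n ⊕ Fin n) (he : Function.Injective e) {z : Fin n ⊕ Fin n → ℝ}
    (hz : Function.Injective z) (hz0 : ∀ i, 0 < z i ∧ z i ≤ 1) (σ : Fin (n + n) ≃ Fin n ⊕ Fin n)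
    (hσ : StrictMono (z ∘ σ)) :
    |phi α μ n (z ∘ Sum.inl)| * |phi α μ n (z ∘ Sum.inr)| * pairKernel H e z ≤
      gapConst α μ H (Fintype.card ι) n c * ∏ l, (gapWeight (min α 1) H (c * leftGap (z ∘ σ) l) *
        Real.exp (-(c * leftGap (z ∘ σ) l))) := by
  have hd := isGapBound_leftGap σ hσ fun i => (hz0 i).1
  set d : Fin n ⊕ Fin n → ℝ := fun i => leftGap (z ∘ σ) (σ.symm i) with hd'
  set a := min α 1
  set A := phiConst α μ
  have hA : 0 ≤ A := zero_le_one.trans (one_le_phiConst α μ)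
  have h1 := abs_phi_le α μ (hd.comp Sum.inl) (hz.comp Sum.inl_injective)
  have h2 := abs_phi_le α μ (hd.comp Sum.inr) (hz.comp Sum.inr_injective)
  have h3 := pairKernel_le hH hc hd hz e he
  -- The merged gaps telescope to the largest point, which is at most `1`; hence exponential damping
  -- costs no more than `exp c`.
  have hexp : 1 ≤ Real.exp c * ∏ i, Real.exp (-(c * d i)) := by
    have h4 : ∑ i, d i ≤ 1 := by
      rw [← Equiv.sum_comp σ]
      simpa [hd'] using sum_leftGap_le (v := z ∘ σ) fun l => (hz0 _).2
    rw [← Real.exp_sum, ← Real.exp_add, Finset.sum_neg_distrib, ← Finset.mul_sum]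
    exact Real.one_le_exp (by nlinarith)
  have hdp : ∀ i, d i ^ (a - 1) = c ^ (1 - a) * (c * d i) ^ (a - 1) := by
    intro i
    rw [Real.mul_rpow hc.le (hd.pos i).le, ← mul_assoc, ← Real.rpow_add hc]
    simp
  have hP : ∏ l, (gapWeight a H (c * leftGap (z ∘ σ) l) * Real.exp (-(c * leftGap (z ∘ σ) l))) =
      ∏ i, (gapWeight a H (c * d i) * Real.exp (-(c * d i))) := by
    rw [← Equiv.prod_comp σ]
    simp [hd']
  have hW : 0 ≤ ∏ i, gapWeight a H (c * d i) :=
    Finset.prod_nonneg fun i _ => gapWeight_nonneg (mul_nonneg hc.le (hd.pos i).le)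
  calc _ ≤ (A ^ n * ∏ i, (d ∘ Sum.inl) i ^ (a - 1)) * (A ^ n * ∏ i, (d ∘ Sum.inr) i ^ (a - 1)) *
        ((c ^ (2 - 2 * H)) ^ Fintype.card ι * ∏ i, max 1 ((c * d i) ^ (2 * H - 2))) := by
        have := Finset.prod_nonneg (s := Finset.univ)
          fun i _ => Real.rpow_nonneg (hd.pos (Sum.inl i)).le (a - 1)
        refine mul_le_mul (mul_le_mul h1 h2 (abs_nonneg _) (mul_nonneg (pow_nonneg hA _) this)) h3
          (pairKernel_nonneg _ _ _) ?_
        refine mul_nonneg (mul_nonneg (pow_nonneg hA _) this) (mul_nonneg (pow_nonneg hA _) ?_)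
        exact Finset.prod_nonneg fun i _ => Real.rpow_nonneg (hd.pos _).le _
    _ = A ^ (n + n) * (c ^ (2 - 2 * H)) ^ Fintype.card ι * (∏ i, d i ^ (a - 1)) *
        ∏ i, max 1 ((c * d i) ^ (2 * H - 2)) := by
        rw [Fintype.prod_sum_type fun i => d i ^ (a - 1), pow_add]
        simp only [Function.comp]
        ring
    _ = A ^ (n + n) * (c ^ (2 - 2 * H)) ^ Fintype.card ι * (c ^ (1 - a)) ^ (n + n) *
        ∏ i, gapWeight a H (c * d i) := by
        simp only [hdp, gapWeight, Finset.prod_mul_distrib, Finset.prod_const, Finset.card_univ,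
          Fintype.card_sum, Fintype.card_fin]
        ring
    _ ≤ A ^ (n + n) * (c ^ (2 - 2 * H)) ^ Fintype.card ι * (c ^ (1 - a)) ^ (n + n) *
        (∏ i, gapWeight a H (c * d i)) * (Real.exp c * ∏ i, Real.exp (-(c * d i))) :=
        le_mul_of_one_le_right (mul_nonneg (by positivity) hW) hexp
    _ = _ := by
        rw [hP, Finset.prod_mul_distrib, gapConst]
        ring

lemma exists_equiv_strictMono {ρ : Type*} {N : ℕ} (e : Fin N ≃ ρ) {z : ρ → ℝ}
    (hz : Function.Injective z) : ∃ σ : Fin N ≃ ρ, StrictMono (z ∘ σ) :=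
  ⟨(Tuple.sort (z ∘ e)).trans e, (Tuple.monotone_sort (z ∘ e)).strictMono_of_injective
    ((hz.comp e.injective).comp (Equiv.injective _))⟩

/-- The ordering of the points varies with `z`. Summing over all orderings keeps the right one, the
other terms being nonnegative, and makes the bound a single explicit function of `z`. -/
lemma enorm_phi_mul_le {H c : ℝ} (hH : H ≤ 1) (hc : 0 < c) (α : ℝ) (μ : ℝ≥0∞) {n : ℕ}
    (e : ι ⊕ ι → Fin n ⊕ Fin n) (he : Function.Injective e) {z : Fin n ⊕ Fin n → ℝ}
    (hz : Function.Injective z) (hz0 : ∀ i, 0 < z i ∧ z i ≤ 1) :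
    ‖phi α μ n (z ∘ Sum.inl)‖ₑ * ‖phi α μ n (z ∘ Sum.inr)‖ₑ * ENNReal.ofReal (pairKernel H e z) ≤
      ENNReal.ofReal (gapConst α μ H (Fintype.card ι) n c) *
        ∑ σ : Fin (n + n) ≃ Fin n ⊕ Fin n,
          ∏ l, gapDensity (min α 1) H (c * leftGap (z ∘ σ) l) := by
  obtain ⟨σ, hσ⟩ := exists_equiv_strictMono (finSumFinEquiv.symm) hz
  have h := abs_phi_mul_le hH hc α μ e he hz hz0 σ hσ
  have hpos : ∀ l, 0 < c * leftGap (z ∘ σ) l :=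
    fun l => mul_pos hc (leftGap_pos hσ (fun _ => (hz0 _).1) l)
  calc _ = ENNReal.ofReal
        (|phi α μ n (z ∘ Sum.inl)| * |phi α μ n (z ∘ Sum.inr)| * pairKernel H e z) := by
        rw [ENNReal.ofReal_mul (by positivity), ENNReal.ofReal_mul (by positivity),
          Real.enorm_eq_ofReal_abs, Real.enorm_eq_ofReal_abs]
    _ ≤ _ := ENNReal.ofReal_le_ofReal h
    _ = ENNReal.ofReal (gapConst α μ H (Fintype.card ι) n c) *
          ∏ l, gapDensity (min α 1) H (c * leftGap (z ∘ σ) l) := by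
        rw [ENNReal.ofReal_mul (gapConst_nonneg _ _ _ _ _ hc), ENNReal.ofReal_prod_of_nonneg
          fun l _ => mul_nonneg (gapWeight_nonneg (hpos l).le) (Real.exp_pos _).le]
        congr 1
        refine Finset.prod_congr rfl fun l _ => ?_
        rw [gapDensity, Set.indicator_of_mem (Set.mem_Ioi.2 (hpos l))]
    _ ≤ _ := by
        gcongr
        exact Finset.single_le_sum
          (f := fun σ : Fin (n + n) ≃ Fin n ⊕ Fin n =>
            ∏ l, gapDensity (min α 1) H (c * leftGap (z ∘ σ) l)) (fun _ _ => zero_le)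
          (Finset.mem_univ σ)

/-- The bound on the integral of `φ_n ⊗ φ_n` against the covariance kernels of a family of
disjoint pairs of variables. -/
lemma lintegral_phi_mul_le {H c : ℝ} (hH : H ≤ 1) (hc : 0 < c) (α : ℝ) (μ : ℝ≥0∞) {n : ℕ}
    (e : ι ⊕ ι → Fin n ⊕ Fin n) (he : Function.Injective e) :
    ∫⁻ z, ‖phi α μ n (z ∘ Sum.inl)‖ₑ * ‖phi α μ n (z ∘ Sum.inr)‖ₑ *
        ENNReal.ofReal (pairKernel H e z) ∂(cubeMeasure (Fin n ⊕ Fin n)) ≤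
      ENNReal.ofReal (gapConst α μ H (Fintype.card ι) n c) * ((n + n)! *
        (ENNReal.ofReal c⁻¹ * ∫⁻ x, gapDensity (min α 1) H x) ^ (n + n)) := by
  have hm : ∀ l, Measurable fun v : Fin (n + n) → ℝ =>
      gapDensity (min α 1) H (c * leftGap v l) :=
    fun l => (measurable_gapDensity _ _).comp ((measurable_leftGap l).const_mul c)
  have hm' : ∀ σ : Fin (n + n) ≃ Fin n ⊕ Fin n, Measurable fun z : Fin n ⊕ Fin n → ℝ =>
      ∏ l, gapDensity (min α 1) H (c * leftGap (z ∘ σ) l) := fun σ =>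
    (Finset.measurable_prod _ fun l _ => hm l).comp (by fun_prop : Measurable fun
      z : Fin n ⊕ Fin n → ℝ => z ∘ σ)
  calc _ ≤ ∫⁻ z, ENNReal.ofReal (gapConst α μ H (Fintype.card ι) n c) *
        ∑ σ : Fin (n + n) ≃ Fin n ⊕ Fin n,
          ∏ l, gapDensity (min α 1) H (c * leftGap (z ∘ σ) l) ∂(cubeMeasure (Fin n ⊕ Fin n)) := by
        refine lintegral_mono_ae ?_
        filter_upwards [ae_injective_cubeMeasure, ae_mem_Ioc_cubeMeasure] with z hz hz0
        exact enorm_phi_mul_le hH hc α μ e he hz hz0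
    -- The cube is enlarged to the whole space. The damping makes this affordable, and the gaps
    -- become independent variables.
    _ ≤ ∫⁻ z : Fin n ⊕ Fin n → ℝ, ENNReal.ofReal (gapConst α μ H (Fintype.card ι) n c) *
        ∑ σ : Fin (n + n) ≃ Fin n ⊕ Fin n,
          ∏ l, gapDensity (min α 1) H (c * leftGap (z ∘ σ) l) := by
        rw [← restrict_Icc_eq_cubeMeasure]
        exact setLIntegral_le_lintegral _ _
    _ = _ := by
        rw [lintegral_const_mul _ (Finset.measurable_sum _ fun σ _ => hm' σ),
          lintegral_finsetSum _ fun σ _ => hm' σ]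
        congr 1
        have hσ : ∀ σ : Fin (n + n) ≃ Fin n ⊕ Fin n, ∫⁻ z : Fin n ⊕ Fin n → ℝ,
            ∏ l, gapDensity (min α 1) H (c * leftGap (z ∘ σ) l) =
            (ENNReal.ofReal c⁻¹ * ∫⁻ x, gapDensity (min α 1) H x) ^ (n + n) := by
          intro σ
          have h1 := lintegral_pi_reindex volume σ fun z : Fin n ⊕ Fin n → ℝ =>
            ∏ l, gapDensity (min α 1) H (c * leftGap (z ∘ σ) l)
          rw [← volume_pi, ← volume_pi] at h1
          rw [h1, ← lintegral_comp_const_mul hc _ (measurable_gapDensity _ _),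
            ← lintegral_prod_gaps (fun y => gapDensity (min α 1) H (c * y))
              ((measurable_gapDensity _ _).comp (measurable_const_mul c)) _ 0]
          simp only [Function.comp_assoc, Equiv.symm_comp_self, Function.comp_id]
          rfl
        simp only [hσ, Finset.sum_const, Finset.card_univ, nsmul_eq_mul]
        rw [Fintype.card_equiv finSumFinEquiv.symm, Fintype.card_fin]

/-! ### The norm of `ψ` -/

/-- The coefficients of the norm `stratNormSq`. -/
noncomputable def stratCoef (n j : ℕ) : ℝ := ((n ! : ℝ) / (j ! * 2 ^ j)) ^ 2 / (n - 2 * j)!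

lemma stratCoef_pos (n j : ℕ) : 0 < stratCoef n j := by
  unfold stratCoef
  positivity

lemma ofReal_stratCoef (n j : ℕ) : ENNReal.ofReal (stratCoef n j) =
    ((n ! : ℝ≥0∞) / ((j ! : ℝ≥0∞) * 2 ^ j)) ^ 2 / ((n - 2 * j)! : ℝ≥0∞) := by
  rw [stratCoef, ENNReal.ofReal_div_of_pos (by positivity), ENNReal.ofReal_pow (by positivity),
    ENNReal.ofReal_div_of_pos (by positivity), ENNReal.ofReal_mul (by positivity),
    ENNReal.ofReal_pow (by positivity)]
  simp only [ENNReal.ofReal_natCast, ENNReal.ofReal_ofNat]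

lemma two_mul_le_of_mem_range {n j : ℕ} (hj : j ∈ Finset.range (n / 2 + 1)) : 2 * j ≤ n := by
  have := Finset.mem_range.1 hj
  omega

lemma stratNormSq_eq (H : ℝ) (n : ℕ) (f : (Fin n → ℝ) → ℝ) (hf : Measurable f) :
    stratNormSq H n f = ∑ j : Finset.range (n / 2 + 1), ENNReal.ofReal (stratCoef n j) *
      ∫⁻ z, ‖f (z ∘ Sum.inl)‖ₑ * ‖f (z ∘ Sum.inr)‖ₑ *
        ENNReal.ofReal (pairKernel H (pairEquiv n j (two_mul_le_of_mem_range j.2)) z)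
          ∂(cubeMeasure (Fin n ⊕ Fin n)) := by
  rw [stratNormSq, ← Finset.sum_coe_sort]
  refine Finset.sum_congr rfl fun j _ => ?_
  rw [ofReal_stratCoef, tensorNormSq_trace H n j (two_mul_le_of_mem_range j.2) _ hf.enorm]

/-- The coefficient equals `m! * C(m,2j) * C(2j,j) / 4^j`; the second binomial coefficient is at
most `4^j` and the first at most `2^m`. -/
lemma stratCoef_le {m j : ℕ} (hj : 2 * j ≤ m) : stratCoef m j ≤ m ! * 2 ^ m := by
  have h1 : m.choose (2 * j) * (2 * j).choose j ≤ 2 ^ m * 2 ^ (2 * j) :=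
    Nat.mul_le_mul (Nat.choose_le_two_pow _ _) (Nat.choose_le_two_pow _ _)
  have h2 := Nat.choose_mul_factorial_mul_factorial hj
  have h3 := Nat.choose_mul_factorial_mul_factorial (show j ≤ 2 * j by omega)
  rw [show 2 * j - j = j by omega] at h3
  rw [← h3] at h2
  have h1' : (m.choose (2 * j) : ℝ) * (2 * j).choose j ≤ 2 ^ m * 2 ^ (2 * j) := by
    exact_mod_cast h1
  have h2' : (m.choose (2 * j) : ℝ) * ((2 * j).choose j * j ! * j !) * (m - 2 * j)! = m ! := by
    exact_mod_cast h2
  rw [stratCoef, div_le_iff₀ (by positivity), div_pow, div_le_iff₀ (by positivity)]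
  calc (m ! : ℝ) ^ 2 = m ! * (((m.choose (2 * j) : ℝ) * (2 * j).choose j) *
        (j ! * j ! * (m - 2 * j)!)) := by rw [sq]; nth_rw 2 [← h2']; ring
    _ ≤ m ! * ((2 ^ m * 2 ^ (2 * j)) * (j ! * j ! * (m - 2 * j)!)) := by gcongr
    _ = _ := by rw [mul_pow (j ! : ℝ), ← pow_mul, mul_comm j 2]; ring

lemma sum_stratCoef_le (m : ℕ) :
    ∑ j : Finset.range (m / 2 + 1), stratCoef m j ≤ m ! * 4 ^ m := by
  calc ∑ j : Finset.range (m / 2 + 1), stratCoef m j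
      ≤ ∑ _j : Finset.range (m / 2 + 1), (m ! * 2 ^ m : ℝ) :=
        Finset.sum_le_sum fun j _ => stratCoef_le (two_mul_le_of_mem_range j.2)
    _ = (m / 2 + 1 : ℕ) * (m ! * 2 ^ m) := by simp
    _ ≤ (2 ^ m : ℕ) * (m ! * 2 ^ m) := by
        gcongr
        have : m < 2 ^ m := Nat.lt_two_pow_self
        omega
    _ = _ := by
        push_cast
        rw [show (4 : ℝ) = 2 * 2 by norm_num, mul_pow]
        ring

/-- Bound `|psi|` by the integral of `|phi|` and restore the integrated variables. They belong to no
pair, which is why the estimates for `phi` assume the pairing injective but not surjective. -/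
lemma lintegral_psi_mul_le (H α : ℝ) (μ : ℝ≥0∞) (m k : ℕ) (e : ι ⊕ ι → Fin m ⊕ Fin m) :
    ∫⁻ z, ‖psi α μ m k (z ∘ Sum.inl)‖ₑ * ‖psi α μ m k (z ∘ Sum.inr)‖ₑ *
        ENNReal.ofReal (pairKernel H e z) ∂(cubeMeasure (Fin m ⊕ Fin m)) ≤
      ∫⁻ z, ‖phi α μ (m + k) (z ∘ Sum.inl)‖ₑ * ‖phi α μ (m + k) (z ∘ Sum.inr)‖ₑ *
        ENNReal.ofReal (pairKernel H (Sum.map (Fin.castAdd k) (Fin.castAdd k) ∘ e) z)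
          ∂(cubeMeasure (Fin (m + k) ⊕ Fin (m + k))) := by
  set A : (Fin m → ℝ) → (Fin k → ℝ) → ℝ≥0∞ := fun x r =>
    ‖phi α μ (m + k) (Fin.append x r)‖ₑ with hAdef
  set K : (Fin m → ℝ) → (Fin m → ℝ) → ℝ≥0∞ := fun x y =>
    ENNReal.ofReal (pairKernel H e (Sum.elim x y)) with hKdef
  have hA : Measurable (Function.uncurry A) :=
    ((measurable_phi α μ (m + k)).comp (measurable_append m k)).enorm
  have hK : Measurable (Function.uncurry K) :=
    ((measurable_pairKernel H e).comp
      (measurable_elim_comp id measurable_fst measurable_snd)).ennreal_ofReal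
  have hF : Measurable fun p : (Fin (m + k) → ℝ) × (Fin (m + k) → ℝ) =>
      ‖phi α μ (m + k) p.1‖ₑ * ‖phi α μ (m + k) p.2‖ₑ * ENNReal.ofReal
        (pairKernel H (Sum.map (Fin.castAdd k) (Fin.castAdd k) ∘ e) (Sum.elim p.1 p.2)) := by
    exact (((measurable_phi α μ (m + k)).comp measurable_fst).enorm.mul
      ((measurable_phi α μ (m + k)).comp measurable_snd).enorm).mul
        ((measurable_pairKernel _ _).comp
          (measurable_elim_comp id measurable_fst measurable_snd)).ennreal_ofReal
  rw [lintegral_pairKernel H m e _ (measurable_psi α μ m k).enorm,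
    lintegral_pairKernel H (m + k) _ _ (measurable_phi α μ (m + k)).enorm]
  calc _ ≤ ∫⁻ x, ∫⁻ y, (∫⁻ r, A x r ∂(cubeMeasure (Fin k))) *
        (∫⁻ r, A y r ∂(cubeMeasure (Fin k))) * K x y
          ∂(cubeMeasure (Fin m)) ∂(cubeMeasure (Fin m)) := by
        gcongr with x y
        · exact enorm_psi_le α μ m k x
        · exact enorm_psi_le α μ m k y
    _ = _ := by
        rw [lintegral_two_copies hA hK, lintegral_append m k _
          (Measurable.lintegral_prod_right' hF)]
        refine lintegral_congr fun x => lintegral_congr fun r => ?_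
        refine Eq.trans ?_ (lintegral_append m k _ (hF.comp measurable_prodMk_left)).symm
        refine lintegral_congr fun y => lintegral_congr fun r' => ?_
        have hz : (Sum.elim (Fin.append x r) (Fin.append y r') : _ → ℝ) ∘
            (Sum.map (Fin.castAdd k) (Fin.castAdd k)) = Sum.elim x y := by
          ext (i | i) <;> simp
        have hp : pairKernel H (Sum.map (Fin.castAdd k) (Fin.castAdd k) ∘ e)
            (Sum.elim (Fin.append x r) (Fin.append y r')) = pairKernel H e (Sum.elim x y) := by
          rw [← hz]; rfl
        simp only [Function.comp, hAdef, hKdef]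
        simp only [hp]
        ring

lemma stratNormSq_psi_le {H c : ℝ} (hH : H ≤ 1) (hc : 0 < c) (α : ℝ) (μ : ℝ≥0∞) (m k : ℕ) :
    stratNormSq H m (psi α μ m k) ≤ ENNReal.ofReal (m ! * 4 ^ m) *
      (ENNReal.ofReal (gapConst α μ H m (m + k) c) * ((m + k + (m + k))! *
        (ENNReal.ofReal c⁻¹ * ∫⁻ x, gapDensity (min α 1) H x) ^ (m + k + (m + k)))) := by
  rw [stratNormSq_eq _ _ _ (measurable_psi α μ m k)]
  calc _ ≤ ∑ j : Finset.range (m / 2 + 1), ENNReal.ofReal (stratCoef m j) *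
        (ENNReal.ofReal (gapConst α μ H m (m + k) c) * ((m + k + (m + k))! *
        (ENNReal.ofReal c⁻¹ * ∫⁻ x, gapDensity (min α 1) H x) ^ (m + k + (m + k)))) := by
        refine Finset.sum_le_sum fun j _ => ?_
        gcongr
        refine (lintegral_psi_mul_le H α μ m k _).trans ?_
        -- Whatever the order `j` of the trace, there are `j + j + (m - 2j) = m` pairs, so one bound
        -- serves for all `j`.
        have hcard : Fintype.card (Fin j ⊕ Fin j ⊕ Fin (m - 2 * j)) = m := by
          have := two_mul_le_of_mem_range j.2
          simp only [Fintype.card_sum, Fintype.card_fin]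
          omega
        refine (lintegral_phi_mul_le hH hc α μ _ ?_).trans_eq (by rw [hcard])
        refine (Sum.map_injective.2 ⟨?_, ?_⟩).comp (Equiv.injective _) <;>
          exact Fin.castAdd_injective m k
    _ ≤ _ := by
        rw [← Finset.sum_mul, ← ENNReal.ofReal_sum_of_nonneg
          (f := fun j : Finset.range (m / 2 + 1) => stratCoef m j)
          fun j _ => (stratCoef_pos m j).le]
        gcongr
        exact sum_stratCoef_le m

/-- The number of orderings of the `2(m+k)` points exceeds `(m! k!)²` by a geometric factor only.
The square is what the coefficients `1 / (m! k!)` of the series compensate. -/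
lemma factorial_add_self_le (m k : ℕ) :
    ((m + k + (m + k))! : ℝ) ≤ (m ! * k !) ^ 2 * 16 ^ (m + k) := by
  have h1 := Nat.add_choose_mul_factorial_mul_factorial (m + k) (m + k)
  have h2 := Nat.add_choose_mul_factorial_mul_factorial m k
  have h3 : (m + k + (m + k)).choose (m + k) ≤ 2 ^ (m + k + (m + k)) := Nat.choose_le_two_pow _ _
  have h4 : (m + k).choose k ≤ 2 ^ (m + k) := Nat.choose_le_two_pow _ _
  have : (m + k + (m + k))! ≤ (m ! * k !) ^ 2 * 16 ^ (m + k) := by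
    calc (m + k + (m + k))! = (m + k + (m + k)).choose (m + k) *
          ((m + k).choose k * m ! * k !) * ((m + k).choose k * m ! * k !) := by
          rw [h2, h1]
      _ ≤ 2 ^ (m + k + (m + k)) * (2 ^ (m + k) * m ! * k !) * (2 ^ (m + k) * m ! * k !) := by
          gcongr
      _ = _ := by
          rw [show 16 = 2 * 2 * 2 * 2 by norm_num, mul_pow (2 * 2 * 2), mul_pow (2 * 2),
            mul_pow 2 2, pow_add]
          ring
  exact_mod_cast this

/-- The growth of the norm of `ψ_{m,k}` in `m` and `k`. -/
lemma exists_stratNormSq_psi_le {H α : ℝ} (hH : H ∈ Set.Ioo (1 / 2 : ℝ) 1)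
    (hαH : 3 / 2 < α + H) (μ : ℝ≥0∞) :
    ∃ B ε : ℝ, 0 ≤ B ∧ 0 < ε ∧ ∀ m k : ℕ, stratNormSq H m (psi α μ m k) ≤
      ENNReal.ofReal ((m ! * k !) ^ 2 * Real.exp 1 *
        ((B * (2 * (m + k : ℕ) + 1 : ℝ) ^ (-ε)) ^ (m + k)) ^ 2) := by
  obtain ⟨hH1, hH2⟩ := hH
  set a := min α 1 with ha
  -- When the minimum is `1`, this is the condition `H > 1/2`.
  have haH : 3 / 2 < a + H := by
    rcases min_choice α 1 with h | h <;> rw [ha, h] <;> linarith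
  set A := phiConst α μ
  have hA : 0 ≤ A := zero_le_one.trans (one_le_phiConst α μ)
  have hD := lintegral_gapDensity_lt_top (a := a) (H := H) (by linarith) (by linarith)
  set D := (∫⁻ x, gapDensity a H x).toReal with hDdef
  have hD0 : 0 ≤ D := ENNReal.toReal_nonneg
  refine ⟨8 * A * Real.exp 1 * D, a + H - 3 / 2, by positivity, by linarith, fun m k => ?_⟩
  set n := m + k with hn
  -- A scale linear in `n`: the damping cost `exp c` stays geometric in `n`, while `c ^ m` dominates
  -- `m!` and the rescaling gains a power of `c`.
  set c : ℝ := 2 * (n : ℝ) + 1 with hc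
  have hc1 : 1 ≤ c := by rw [hc]; linarith [(Nat.cast_nonneg n : (0 : ℝ) ≤ n)]
  have hc0 : 0 < c := by linarith
  refine (stratNormSq_psi_le hH2.le hc0 α μ m k).trans ?_
  rw [← ENNReal.ofReal_toReal hD.ne, ← hDdef, ← ENNReal.ofReal_mul (by positivity),
    ← ENNReal.ofReal_pow (by positivity), ← ENNReal.ofReal_natCast (n + n)!,
    ← ENNReal.ofReal_mul (by positivity), ← ENNReal.ofReal_mul (gapConst_nonneg _ _ _ _ _ hc0),
    ← ENNReal.ofReal_mul (by positivity)]
  refine ENNReal.ofReal_le_ofReal ?_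
  have h1 : (m ! : ℝ) ≤ c ^ m := by
    calc (m ! : ℝ) ≤ (m : ℝ) ^ m := by exact_mod_cast Nat.factorial_le_pow m
      _ ≤ c ^ m := by
        gcongr
        have : (m : ℝ) ≤ n := by exact_mod_cast Nat.le_add_right m k
        linarith [(Nat.cast_nonneg n : (0 : ℝ) ≤ n)]
  have h2 : (4 : ℝ) ^ m ≤ 4 ^ n := pow_le_pow_right₀ (by norm_num) (Nat.le_add_right m k)
  have h3 := factorial_add_self_le m k
  rw [← hn] at h3
  have hexp : Real.exp c = Real.exp 1 * (Real.exp 1 ^ n) ^ 2 := by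
    rw [← Real.exp_nat_mul, ← Real.exp_nat_mul, ← Real.exp_add, hc]
    congr 1
    push_cast
    ring
  -- The balance of powers of `c`: the exponent on the left is `m(3 - 2H) - 2na`, at most `n(3 - 2H
  -- - 2a)` since `m ≤ n` and `H < 1`. The first factor `c ^ m` stands for the `m!` in the
  -- coefficients of the norm.
  have hpow : c ^ m * (c ^ (2 - 2 * H)) ^ m * (c ^ (1 - a)) ^ (n + n) * (c⁻¹) ^ (n + n) ≤
      ((c ^ (-(a + H - 3 / 2))) ^ n) ^ 2 := by
    rw [← Real.rpow_natCast c m, ← Real.rpow_natCast (c ^ (2 - 2 * H)) m,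
      ← Real.rpow_natCast (c ^ (1 - a)), ← Real.rpow_natCast (c⁻¹), ← Real.rpow_neg_one c,
      ← Real.rpow_natCast _ 2, ← Real.rpow_natCast _ n,
      ← Real.rpow_mul hc0.le, ← Real.rpow_mul hc0.le, ← Real.rpow_mul hc0.le,
      ← Real.rpow_mul hc0.le, ← Real.rpow_mul hc0.le, ← Real.rpow_add hc0, ← Real.rpow_add hc0,
      ← Real.rpow_add hc0]
    refine Real.rpow_le_rpow_of_exponent_le hc1 ?_
    have hmn : (n : ℝ) = m + k := by rw [hn]; push_cast; ring
    have hk0 : (0 : ℝ) ≤ k := Nat.cast_nonneg k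
    push_cast
    rw [hmn]
    nlinarith
  unfold gapConst
  calc _ = m ! * 4 ^ m * (A ^ (n + n) * (c ^ (2 - 2 * H)) ^ m * (c ^ (1 - a)) ^ (n + n) *
        Real.exp c * ((n + n)! * (c⁻¹ * D) ^ (n + n))) := rfl
    _ ≤ c ^ m * 4 ^ n * (A ^ (n + n) * (c ^ (2 - 2 * H)) ^ m * (c ^ (1 - a)) ^ (n + n) *
        Real.exp c * (((m ! * k !) ^ 2 * 16 ^ n) * (c⁻¹ * D) ^ (n + n))) := by gcongr
    _ = (m ! * k !) ^ 2 * Real.exp 1 * ((8 * A * Real.exp 1 * D) ^ n) ^ 2 *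
        (c ^ m * (c ^ (2 - 2 * H)) ^ m * (c ^ (1 - a)) ^ (n + n) * (c⁻¹) ^ (n + n)) := by
        have h64 : (8 ^ n : ℝ) ^ 2 = 4 ^ n * 16 ^ n := by
          rw [← mul_pow, ← pow_mul, mul_comm n 2, pow_mul]
          norm_num
        rw [hexp, mul_pow c⁻¹ D, pow_add A, pow_add D, mul_pow _ D n, mul_pow _ (Real.exp 1) n,
          mul_pow 8 A n, mul_pow _ (D ^ n) 2, mul_pow _ (Real.exp 1 ^ n) 2, mul_pow _ (A ^ n) 2,
          h64]
        ring
    _ ≤ (m ! * k !) ^ 2 * Real.exp 1 * ((8 * A * Real.exp 1 * D) ^ n) ^ 2 *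
        ((c ^ (-(a + H - 3 / 2))) ^ n) ^ 2 := by gcongr
    _ = _ := by rw [mul_pow _ (c ^ _) n, mul_pow _ _ 2]; ring

lemma stratNormSq_psi_lt_top {H α : ℝ} (hH : H ∈ Set.Ioo (1 / 2 : ℝ) 1)
    (hαH : 3 / 2 < α + H) (μ : ℝ≥0∞) (m k : ℕ) : stratNormSq H m (psi α μ m k) < ∞ := by
  obtain ⟨B, ε, -, -, h⟩ := exists_stratNormSq_psi_le hH hαH μ
  exact (h m k).trans_lt ENNReal.ofReal_lt_top

/-! ### Moments of pairs of jointly Gaussian variables -/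

lemma Gamma_nat_add_half_eq (n : ℕ) :
    Real.Gamma (n + 1 / 2) = (2 * n)! / (4 ^ n * n !) * √Real.pi := by
  induction n with
  | zero => simp [-one_div, Real.Gamma_one_half_eq]
  | succ n ih =>
    rw [show ((n + 1 : ℕ) : ℝ) + 1 / 2 = (n + 1 / 2) + 1 by push_cast; ring,
      Real.Gamma_add_one (by positivity), ih, show 2 * (n + 1) = 2 * n + 1 + 1 by ring,
      Nat.factorial_succ (2 * n + 1), Nat.factorial_succ (2 * n), Nat.factorial_succ n]
    push_cast
    field_simp
    ring

lemma integral_pow_gaussianReal (v : ℝ≥0) (n : ℕ) :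
    ∫ x, x ^ (2 * n) ∂(gaussianReal 0 v) = (2 * n)! / (2 ^ n * n !) * (v : ℝ) ^ n := by
  by_cases hv : v = 0
  · subst hv
    rw [gaussianReal_zero_var, integral_dirac]
    cases n with
    | zero => simp
    | succ n => simp
  have hv0 : (0 : ℝ) < v := by positivity
  rw [integral_gaussianReal_eq_integral_smul hv]
  set b : ℝ := (2 * v)⁻¹ with hb
  have hb0 : 0 < b := by positivity
  have h1 : ∀ x : ℝ, gaussianPDFReal 0 v x • x ^ (2 * n) =
      (√(2 * Real.pi * v))⁻¹ *
          (fun y : ℝ => y ^ ((2 * n : ℕ) : ℝ) * Real.exp (-b * y ^ (2 : ℝ))) |x| := by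
    intro x
    simp only [gaussianPDFReal, smul_eq_mul, sub_zero, Real.rpow_natCast, Real.rpow_two, sq_abs,
      pow_mul, hb]
    rw [show -x ^ 2 / (2 * (v : ℝ)) = -(2 * (v : ℝ))⁻¹ * x ^ 2 by field_simp]
    ring
  simp only [h1]
  rw [integral_const_mul,
    integral_comp_abs (f := fun y : ℝ => y ^ ((2 * n : ℕ) : ℝ) * Real.exp (-b * y ^ (2 : ℝ))),
    integral_rpow_mul_exp_neg_mul_rpow (by norm_num) (by
      have : (0 : ℝ) ≤ ((2 * n : ℕ) : ℝ) := Nat.cast_nonneg _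
      linarith) hb0]
  have h2 : (((2 * n : ℕ) : ℝ) + 1) / 2 = n + 1 / 2 := by push_cast; ring
  rw [neg_div, h2, Gamma_nat_add_half_eq, hb, Real.inv_rpow (by positivity),
    Real.rpow_neg (by positivity),
    inv_inv, Real.rpow_add (by positivity), Real.rpow_natCast, ← Real.sqrt_eq_rpow,
    show 2 * Real.pi * (v : ℝ) = Real.pi * (2 * v) by ring, Real.sqrt_mul (by positivity),
    show (4 : ℝ) = 2 * 2 by norm_num, mul_pow 2 2, mul_pow 2 (v : ℝ)]
  have h3 : 0 < √(2 * (v : ℝ)) := by positivity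
  have h4 : 0 < √Real.pi := by positivity
  field_simp

lemma integral_pow_of_hasGaussianLaw {Ω : Type*} [MeasurableSpace Ω] {P : Measure Ω}
    [IsProbabilityMeasure P] {X : Ω → ℝ} (hX : HasGaussianLaw X P) (h0 : ∫ ω, X ω ∂P = 0) (n : ℕ) :
    ∫ ω, X ω ^ (2 * n) ∂P = (2 * n)! / (2 ^ n * n !) * (∫ ω, X ω ^ 2 ∂P) ^ n := by
  have h1 := integral_map (f := fun x : ℝ => x ^ (2 * n)) hX.aemeasurable (by fun_prop)
  have hvar : Var[X; P] = ∫ ω, X ω ^ 2 ∂P := by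
    rw [variance_eq_integral hX.aemeasurable, h0]
    simp
  rw [← h1, hX.map_eq_gaussianReal, h0, integral_pow_gaussianReal, Real.coe_toNNReal _
    (variance_nonneg _ _), hvar]

open Polynomial in
lemma coeff_C_add_C_mul_X_pow (a c : ℝ) (m k : ℕ) :
    ((C a + C c * X) ^ m).coeff k = m.choose k * a ^ (m - k) * c ^ k := by
  rw [add_comm, add_pow, finsetSum_coeff]
  have : ∀ i ∈ Finset.range (m + 1),
      ((C c * X) ^ i * C a ^ (m - i) * (m.choose i : ℝ[X])).coeff k =
      if i = k then m.choose k * a ^ (m - k) * c ^ k else 0 := by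
    intro i _
    rw [mul_pow, ← C_pow, ← C_pow, ← C_eq_natCast, mul_assoc, mul_assoc, coeff_C_mul, ← C_mul,
      coeff_mul_C, coeff_X_pow]
    split_ifs with h1 h2 h2
    · subst h1; ring
    · exact absurd h1.symm h2
    · exact absurd h2.symm h1
    · simp
  rw [Finset.sum_congr rfl this, Finset.sum_ite_eq']
  split_ifs with h
  · rfl
  · rw [Nat.choose_eq_zero_of_lt (by simpa using h)]
    simp

open Polynomial in
-- A trinomial expansion in two stages: the terms `a` and `c X²` combine to a polynomial in `X²`, so
-- only an even number `2j` of factors can come from them; degree `n` then forces `j` of each.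
lemma coeff_quadratic_pow (a b c : ℝ) (n : ℕ) :
    ((C a + C c * X ^ 2 + C b * X) ^ n).coeff n =
      ∑ j ∈ Finset.range (n / 2 + 1),
        n.choose (2 * j) * ((2 * j).choose j * a ^ j * c ^ j) * b ^ (n - 2 * j) := by
  rw [add_pow, finsetSum_coeff]
  have hexp : ∀ m, (C a + C c * X ^ 2 : ℝ[X]) ^ m = expand ℝ 2 ((C a + C c * X) ^ m) := by
    intro m; simp
  have h1 : ∀ m ∈ Finset.range (n + 1),
      ((C a + C c * X ^ 2 : ℝ[X]) ^ m * (C b * X) ^ (n - m) * (n.choose m : ℝ[X])).coeff n =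
      if 2 ∣ m then n.choose m * (m.choose (m / 2) * a ^ (m - m / 2) * c ^ (m / 2)) * b ^ (n - m)
      else 0 := by
    intro m hm
    have hmn : m ≤ n := Nat.lt_succ_iff.1 (Finset.mem_range.1 hm)
    rw [mul_pow, ← C_pow, ← C_eq_natCast, coeff_mul_C, ← mul_assoc, coeff_mul_X_pow',
      if_pos (Nat.sub_le _ _), coeff_mul_C, Nat.sub_sub_self hmn, hexp,
      coeff_expand (by norm_num), coeff_C_add_C_mul_X_pow]
    split_ifs
    · ring
    · simp
  rw [Finset.sum_congr rfl h1, ← Finset.sum_filter]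
  refine (Finset.sum_nbij' (fun j => 2 * j) (fun m => m / 2) ?_ ?_ ?_ ?_ ?_).symm
  · intro j hj
    simp only [Finset.mem_range, Finset.mem_filter] at hj ⊢
    exact ⟨by omega, dvd_mul_right _ _⟩
  · intro m hm
    simp only [Finset.mem_range, Finset.mem_filter] at hm ⊢
    omega
  · intro j _
    simp
  · intro m hm
    simp only [Finset.mem_filter] at hm
    omega
  · intro j _
    rw [show 2 * j / 2 = j by omega, show 2 * j - j = j by omega]

lemma abs_pow_mul_pow_le (x y : ℝ) (i k : ℕ) : ‖x ^ i * y ^ k‖ ≤ ‖x‖ ^ (i + k) + ‖y‖ ^ (i + k) := by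
  rw [norm_mul, norm_pow, norm_pow]
  rcases le_total ‖x‖ ‖y‖ with h | h
  · calc ‖x‖ ^ i * ‖y‖ ^ k ≤ ‖y‖ ^ i * ‖y‖ ^ k := by gcongr
      _ = ‖y‖ ^ (i + k) := (pow_add _ _ _).symm
      _ ≤ _ := le_add_of_nonneg_left (by positivity)
  · calc ‖x‖ ^ i * ‖y‖ ^ k ≤ ‖x‖ ^ i * ‖x‖ ^ k := by gcongr
      _ = ‖x‖ ^ (i + k) := (pow_add _ _ _).symm
      _ ≤ _ := le_add_of_nonneg_right (by positivity)

section Gaussian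

variable {Ω : Type*} [MeasurableSpace Ω] {P : Measure Ω} [IsProbabilityMeasure P]

lemma integrable_pow_mul_pow {X Y : Ω → ℝ} (hX : HasGaussianLaw X P) (hY : HasGaussianLaw Y P)
    (i k : ℕ) : Integrable (fun ω => X ω ^ i * Y ω ^ k) P := by
  have h : ∀ {Z : Ω → ℝ}, HasGaussianLaw Z P → Integrable (fun ω => ‖Z ω‖ ^ (i + k)) P :=
    fun hZ => (hZ.memLp (ENNReal.natCast_ne_top (i + k))).integrable_norm_pow'
  have hXm := hX.aemeasurable
  have hYm := hY.aemeasurable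
  exact ((h hX).add (h hY)).mono' (by fun_prop) (.of_forall fun ω => abs_pow_mul_pow_le _ _ _ _)

/-- The mixed moments of a centred Gaussian pair. -/
lemma integral_pow_mul_pow {X Y : Ω → ℝ} (hXY : HasGaussianLaw (fun ω => (X ω, Y ω)) P)
    (hX0 : ∫ ω, X ω ∂P = 0) (hY0 : ∫ ω, Y ω ∂P = 0) (n : ℕ) :
    ∫ ω, X ω ^ n * Y ω ^ n ∂P = ∑ j ∈ Finset.range (n / 2 + 1), stratCoef n j *
      ((∫ ω, X ω * X ω ∂P) ^ j * (∫ ω, Y ω * Y ω ∂P) ^ j *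
        (∫ ω, X ω * Y ω ∂P) ^ (n - 2 * j)) := by
  set a := ∫ ω, X ω * X ω ∂P with ha
  set c := ∫ ω, Y ω * Y ω ∂P with hc
  set b := ∫ ω, X ω * Y ω ∂P with hb
  have hX := hXY.fst
  have hY := hXY.snd
  have hint := integrable_pow_mul_pow hX hY
  have hlin : ∀ y : ℝ, HasGaussianLaw (fun ω => X ω + y * Y ω) P := by
    intro y
    have := hXY.map_fun (ContinuousLinearMap.fst ℝ ℝ ℝ + y • ContinuousLinearMap.snd ℝ ℝ ℝ)
    simpa using this
  have hlin0 : ∀ y : ℝ, ∫ ω, X ω + y * Y ω ∂P = 0 := by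
    intro y
    rw [integral_add hX.integrable (hY.integrable.const_mul y), integral_const_mul, hX0, hY0]
    simp
  have hsq : ∀ y : ℝ, ∫ ω, (X ω + y * Y ω) ^ 2 ∂P = a + c * y ^ 2 + 2 * b * y := by
    intro y
    have h1 : ∀ ω, (X ω + y * Y ω) ^ 2 =
        X ω ^ 2 * Y ω ^ 0 + y ^ 2 * (X ω ^ 0 * Y ω ^ 2) + (2 * y) * (X ω ^ 1 * Y ω ^ 1) := by
      intro ω; ring
    simp only [h1]
    have h2 := (hint 0 2).const_mul (y ^ 2)
    have h3 : Integrable (fun ω => X ω ^ 2 * Y ω ^ 0 + y ^ 2 * (X ω ^ 0 * Y ω ^ 2)) P :=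
      (hint 2 0).add h2
    rw [integral_add h3 ((hint 1 1).const_mul _), integral_add (hint 2 0) h2, integral_const_mul,
      integral_const_mul]
    simp only [pow_zero, mul_one, one_mul, pow_one, sq, ← ha, ← hb, ← hc]
    ring
  have hpow : ∀ y : ℝ, ∫ ω, (X ω + y * Y ω) ^ (2 * n) ∂P =
      ∑ i ∈ Finset.range (2 * n + 1),
        (2 * n).choose i * (∫ ω, X ω ^ (2 * n - i) * Y ω ^ i ∂P) * y ^ i := by
    intro y
    have h1 : ∀ ω, (X ω + y * Y ω) ^ (2 * n) = ∑ i ∈ Finset.range (2 * n + 1),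
        ((2 * n).choose i * y ^ i) * (X ω ^ (2 * n - i) * Y ω ^ i) := by
      intro ω
      rw [add_comm, add_pow]
      refine Finset.sum_congr rfl fun i _ => ?_
      rw [mul_pow]
      ring
    simp only [h1]
    rw [integral_finsetSum _ fun i _ => (hint _ _).const_mul _]
    refine Finset.sum_congr rfl fun i _ => ?_
    rw [integral_const_mul]
    ring
  -- Polarisation: the `2n`-th moment of the centred Gaussian variable `X + yY` is computed by
  -- expanding the power and from its variance. The results agree for all `y`, hence as polynomials,
  -- and the coefficient of `y^n` isolates the desired moment.
  have hpoly : (∑ i ∈ Finset.range (2 * n + 1), Polynomial.C ((2 * n).choose i *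
        (∫ ω, X ω ^ (2 * n - i) * Y ω ^ i ∂P)) * Polynomial.X ^ i : Polynomial ℝ) =
      Polynomial.C ((2 * n)! / (2 ^ n * n !) : ℝ) * (Polynomial.C a +
        Polynomial.C c * Polynomial.X ^ 2 + Polynomial.C (2 * b) * Polynomial.X) ^ n := by
    refine Polynomial.funext fun y => ?_
    have := integral_pow_of_hasGaussianLaw (hlin y) (hlin0 y) n
    rw [hpow, hsq] at this
    simpa [Polynomial.eval_finsetSum] using this
  have hcoef := congrArg (fun p => Polynomial.coeff p n) hpoly
  simp only [Polynomial.finsetSum_coeff, Polynomial.coeff_C_mul, Polynomial.coeff_X_pow,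
    coeff_quadratic_pow, mul_ite, mul_one, mul_zero] at hcoef
  rw [Finset.sum_ite_eq, if_pos (Finset.mem_range.2 (by omega)), show 2 * n - n = n by omega]
    at hcoef
  have hch : ((2 * n).choose n : ℝ) * (n ! * n !) = (2 * n)! := by
    have := Nat.choose_mul_factorial_mul_factorial (show n ≤ 2 * n by omega)
    rw [show 2 * n - n = n by omega, mul_assoc] at this
    exact_mod_cast this
  have hch0 : (0 : ℝ) < (2 * n).choose n := by
    exact_mod_cast Nat.choose_pos (by omega)
  refine mul_left_cancel₀ hch0.ne' (hcoef.trans ?_)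
  rw [Finset.mul_sum, Finset.mul_sum]
  refine Finset.sum_congr rfl fun j hj => ?_
  have hjn := two_mul_le_of_mem_range hj
  have h2 : (n.choose (2 * j) : ℝ) * ((2 * j).choose j * j ! * j !) * (n - 2 * j)! = n ! := by
    have h3 := Nat.choose_mul_factorial_mul_factorial hjn
    have h4 := Nat.choose_mul_factorial_mul_factorial (show j ≤ 2 * j by omega)
    rw [show 2 * j - j = j by omega] at h4
    rw [← h4] at h3
    exact_mod_cast h3
  have h5 : (2 : ℝ) ^ n = 2 ^ (n - 2 * j) * (2 ^ j) ^ 2 := by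
    rw [← pow_mul, ← pow_add]
    congr 1
    omega
  have h6 : (n.choose (2 * j) : ℝ) * (2 * j).choose j = n ! / (j ! * j ! * (n - 2 * j)!) := by
    rw [eq_div_iff (by positivity), ← h2]
    ring
  rw [← hch, stratCoef, mul_pow 2 b, h5]
  calc _ = ((2 * n).choose n : ℝ) * (n ! * n !) /
        (2 ^ (n - 2 * j) * (2 ^ j) ^ 2 * n !) * ((n.choose (2 * j) : ℝ) * (2 * j).choose j *
          (a ^ j * c ^ j * (2 ^ (n - 2 * j) * b ^ (n - 2 * j)))) := by ring
    _ = _ := by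
        rw [h6]
        field_simp

end Gaussian

/-! ### Positive definiteness of the covariance kernel -/

section PosDef

variable {X Z : Type*} [MeasurableSpace X] [MeasurableSpace Z] {μ : Measure X} {ν : Measure Z}
  [SFinite μ] [SFinite ν] {h : X → Z → ℝ≥0∞} {k : X → X → ℝ≥0∞} {C : ℝ≥0∞}

/-- Tonelli's theorem diagonalises the bilinear form of a kernel that is a mixture of products. The
factorisation is needed only for almost every `y`, as covariance kernels fail it on the diagonal. -/
lemma lintegral_factor (hh : Measurable (Function.uncurry h)) (hk : Measurable (Function.uncurry k))
    (hC : ∀ x, ∀ᵐ y ∂μ, C * k x y = ∫⁻ z, h x z * h y z ∂ν) {f g : X → ℝ≥0∞}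
    (hf : Measurable f) (hg : Measurable g) :
    C * ∫⁻ x, ∫⁻ y, f x * g y * k x y ∂μ ∂μ =
      ∫⁻ z, (∫⁻ x, f x * h x z ∂μ) * (∫⁻ y, g y * h y z ∂μ) ∂ν := by
  have hhx : ∀ x, Measurable (h x) := fun x => hh.comp measurable_prodMk_left
  have hhz : ∀ z, Measurable fun x => h x z := fun z => hh.comp measurable_prodMk_right
  have hfk : Measurable fun p : X × X => f p.1 * g p.2 * k p.1 p.2 :=
    ((hf.comp measurable_fst).mul (hg.comp measurable_snd)).mul hk
  have hG : Measurable fun z => ∫⁻ y, g y * h y z ∂μ :=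
    Measurable.lintegral_prod_left' (f := fun p : X × Z => g p.1 * h p.1 p.2)
      ((hg.comp measurable_fst).mul hh)
  have hfh : Measurable fun p : X × Z => f p.1 * h p.1 p.2 := (hf.comp measurable_fst).mul hh
  calc C * ∫⁻ x, ∫⁻ y, f x * g y * k x y ∂μ ∂μ
      = ∫⁻ x, ∫⁻ y, C * (f x * g y * k x y) ∂μ ∂μ := by
        rw [← lintegral_const_mul _ hfk.lintegral_prod_right']
        refine lintegral_congr fun x => ?_
        exact (lintegral_const_mul _ (hfk.comp measurable_prodMk_left)).symm
    _ = ∫⁻ x, ∫⁻ y, ∫⁻ z, f x * h x z * (g y * h y z) ∂ν ∂μ ∂μ := by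
        refine lintegral_congr fun x => lintegral_congr_ae ?_
        filter_upwards [hC x] with y hy
        have hxy : Measurable fun z => h x z * h y z := (hhx x).mul (hhx y)
        rw [mul_left_comm, hy, ← lintegral_const_mul _ hxy]
        refine lintegral_congr fun z => ?_
        ring
    _ = ∫⁻ x, ∫⁻ z, f x * h x z * ∫⁻ y, g y * h y z ∂μ ∂ν ∂μ := by
        refine lintegral_congr fun x => ?_
        rw [lintegral_lintegral_swap]
        · refine lintegral_congr fun z => ?_
          have hgz : Measurable fun y => g y * h y z := hg.mul (hhz z)
          rw [lintegral_const_mul _ hgz]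
        · exact Measurable.aemeasurable (.mul
            (((hhx x).comp measurable_snd).const_mul _) ((hg.comp measurable_fst).mul hh))
    _ = _ := by
        rw [lintegral_lintegral_swap]
        · refine lintegral_congr fun z => ?_
          have hfz : Measurable fun x => f x * h x z := hf.mul (hhz z)
          rw [lintegral_mul_const _ hfz]
        · exact (hfh.mul (hG.comp measurable_snd)).aemeasurable

lemma add_mul_self_le (a b : ℝ≥0∞) : (a + b) * (a + b) ≤ 2 * (a * a) + 2 * (b * b) := by
  have h : 2 * (a * b) ≤ a * a + b * b := by
    rcases le_total a b with hab | hab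
    · obtain ⟨c, rfl⟩ := exists_add_of_le hab
      calc 2 * (a * (a + c)) ≤ 2 * (a * (a + c)) + c * c := le_self_add
        _ = _ := by ring
    · obtain ⟨c, rfl⟩ := exists_add_of_le hab
      calc 2 * ((b + c) * b) ≤ 2 * ((b + c) * b) + c * c := le_self_add
        _ = _ := by ring
  calc (a + b) * (a + b) = a * a + b * b + 2 * (a * b) := by ring
    _ ≤ a * a + b * b + (a * a + b * b) := by gcongr
    _ = _ := by ring

/-- After diagonalisation the form is an integral of squares, and `(a + b)² ≤ 2a² + 2b²` applies
under the integral. The constant `C` is cancelled at the start, which requires it to be nonzero and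
finite. -/
lemma lintegral_quadratic_add_le (hh : Measurable (Function.uncurry h))
    (hk : Measurable (Function.uncurry k))
    (hC : ∀ x, ∀ᵐ y ∂μ, C * k x y = ∫⁻ z, h x z * h y z ∂ν) (hC0 : C ≠ 0) (hCt : C ≠ ∞)
    {f g : X → ℝ≥0∞} (hf : Measurable f) (hg : Measurable g) :
    ∫⁻ x, ∫⁻ y, (f x + g x) * (f y + g y) * k x y ∂μ ∂μ ≤
      2 * ∫⁻ x, ∫⁻ y, f x * f y * k x y ∂μ ∂μ + 2 * ∫⁻ x, ∫⁻ y, g x * g y * k x y ∂μ ∂μ := by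
  rw [← ENNReal.mul_le_mul_iff_right hC0 hCt, mul_add, mul_left_comm C 2, mul_left_comm C 2,
    lintegral_factor (f := fun x => f x + g x) (g := fun x => f x + g x) hh hk hC (hf.add hg)
      (hf.add hg), lintegral_factor hh hk hC hf hf,
    lintegral_factor hh hk hC hg hg]
  have hhz : ∀ z, Measurable fun x => h x z := fun z => hh.comp measurable_prodMk_right
  have hm : ∀ {f : X → ℝ≥0∞}, Measurable f → Measurable fun z => ∫⁻ x, f x * h x z ∂μ :=
    fun hf => Measurable.lintegral_prod_left' (f := fun p : X × Z => _ * h p.1 p.2)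
      ((hf.comp measurable_fst).mul hh)
  have hmm : ∀ {f : X → ℝ≥0∞}, Measurable f →
      Measurable fun z => (∫⁻ x, f x * h x z ∂μ) * ∫⁻ x, f x * h x z ∂μ :=
    fun hf => (hm hf).mul (hm hf)
  rw [← lintegral_const_mul _ (hmm hf), ← lintegral_const_mul _ (hmm hg),
    ← lintegral_add_left ((hmm hf).const_mul 2)]
  refine lintegral_mono fun z => ?_
  simp only [add_mul]
  have hfz : Measurable fun x => f x * h x z := hf.mul (hhz z)
  rw [lintegral_add_left hfz]
  exact add_mul_self_le _ _

end PosDef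

/-- The profile of the factorisation of the covariance kernel. -/
noncomputable def factorProfile (H : ℝ) : ℝ → ℝ≥0∞ :=
  (Set.Ioi 0).indicator fun x => ENNReal.ofReal (x ^ (H - 3 / 2))

lemma measurable_factorProfile (H : ℝ) : Measurable (factorProfile H) :=
  Measurable.indicator (by fun_prop) measurableSet_Ioi

lemma factorProfile_mul {H c x : ℝ} (hc : 0 < c) :
    factorProfile H (c * x) = ENNReal.ofReal (c ^ (H - 3 / 2)) * factorProfile H x := by
  unfold factorProfile
  by_cases hx : 0 < x
  · rw [Set.indicator_of_mem (Set.mem_Ioi.2 (mul_pos hc hx)),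
      Set.indicator_of_mem (Set.mem_Ioi.2 hx), Real.mul_rpow hc.le hx.le,
      ENNReal.ofReal_mul (by positivity)]
  · rw [Set.indicator_of_notMem, Set.indicator_of_notMem (by simpa using hx), mul_zero]
    simpa using mul_nonpos_of_nonneg_of_nonpos hc.le (not_lt.1 hx)

/-- The constant of the factorisation of the covariance kernel. -/
noncomputable def factorConst (H : ℝ) : ℝ≥0∞ :=
  ∫⁻ x, factorProfile H x * factorProfile H (x + 1)

lemma factorConst_ne_zero (H : ℝ) (hH : H < 1) : factorConst H ≠ 0 := by
  have h : ENNReal.ofReal (2 ^ (H - 3 / 2)) ≤ factorConst H := by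
    calc ENNReal.ofReal (2 ^ (H - 3 / 2)) = ∫⁻ _x in Set.Ioc (0 : ℝ) 1,
          ENNReal.ofReal (2 ^ (H - 3 / 2)) := by simp
      _ ≤ ∫⁻ x in Set.Ioc (0 : ℝ) 1, factorProfile H x * factorProfile H (x + 1) := by
          refine setLIntegral_mono' measurableSet_Ioc fun x hx => ?_
          rw [factorProfile, Set.indicator_of_mem (Set.mem_Ioi.2 hx.1),
            Set.indicator_of_mem (Set.mem_Ioi.2 (by linarith [hx.1])),
            ← ENNReal.ofReal_mul (Real.rpow_nonneg hx.1.le _)]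
          refine ENNReal.ofReal_le_ofReal ?_
          have h1 : 1 ≤ x ^ (H - 3 / 2) :=
            Real.one_le_rpow_of_pos_of_le_one_of_nonpos hx.1 hx.2 (by linarith)
          have h2 : (2 : ℝ) ^ (H - 3 / 2) ≤ (x + 1) ^ (H - 3 / 2) :=
            Real.rpow_le_rpow_of_nonpos (by linarith [hx.1]) (by linarith [hx.2]) (by linarith)
          calc (2 : ℝ) ^ (H - 3 / 2) ≤ 1 * (x + 1) ^ (H - 3 / 2) := by rwa [one_mul]
            _ ≤ _ := mul_le_mul_of_nonneg_right h1 (Real.rpow_nonneg (by linarith [hx.1]) _)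
      _ ≤ _ := setLIntegral_le_lintegral _ _
  intro h0
  rw [h0, nonpos_iff_eq_zero, ENNReal.ofReal_eq_zero] at h
  exact absurd h (not_le.2 (by positivity))

/-- The integrand is at most `x^(H - 3/2)` on `(0,1]`, integrable because `H > 1/2`, and at most
`x^(2H - 3)` beyond `1`, integrable because `H < 1`. -/
lemma factorConst_ne_top {H : ℝ} (hH : H ∈ Set.Ioo (1 / 2 : ℝ) 1) : factorConst H ≠ ∞ := by
  obtain ⟨hH1, hH2⟩ := hH
  have h1 : IntegrableOn (fun x : ℝ => x ^ (H - 3 / 2)) (Set.Ioc 0 1) :=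
    (intervalIntegrable_iff_integrableOn_Ioc_of_le zero_le_one).1
      (intervalIntegral.intervalIntegrable_rpow' (by linarith))
  have h2 : IntegrableOn (fun x : ℝ => x ^ (2 * H - 3)) (Set.Ioi 1) :=
    integrableOn_Ioi_rpow_of_lt (by linarith) one_pos
  have hle : ∀ x, factorProfile H x * factorProfile H (x + 1) ≤
      (Set.Ioc 0 1).indicator (fun x : ℝ => ENNReal.ofReal (x ^ (H - 3 / 2))) x +
      (Set.Ioi 1).indicator (fun x : ℝ => ENNReal.ofReal (x ^ (2 * H - 3))) x := by
    intro x
    by_cases hx : 0 < x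
    · rw [factorProfile, Set.indicator_of_mem (Set.mem_Ioi.2 hx),
        Set.indicator_of_mem (Set.mem_Ioi.2 (by linarith)),
        ← ENNReal.ofReal_mul (by positivity)]
      by_cases hx1 : x ≤ 1
      · rw [Set.indicator_of_mem (Set.mem_Ioc.2 ⟨hx, hx1⟩)]
        refine le_add_right (ENNReal.ofReal_le_ofReal (mul_le_of_le_one_right (by positivity) ?_))
        exact Real.rpow_le_one_of_one_le_of_nonpos (by linarith) (by linarith)
      · rw [Set.indicator_of_mem (s := Set.Ioi 1) (Set.mem_Ioi.2 (not_le.1 hx1))]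
        refine le_add_left (ENNReal.ofReal_le_ofReal ?_)
        rw [show 2 * H - 3 = (H - 3 / 2) + (H - 3 / 2) by ring, Real.rpow_add hx]
        gcongr ?_ * ?_
        exact Real.rpow_le_rpow_of_nonpos hx (by linarith) (by linarith)
    · rw [factorProfile, Set.indicator_of_notMem (by simpa using hx), zero_mul]
      exact zero_le
  refine ((lintegral_mono hle).trans_lt ?_).ne
  rw [lintegral_add_left (Measurable.indicator (by fun_prop) measurableSet_Ioc),
    lintegral_indicator measurableSet_Ioc, lintegral_indicator measurableSet_Ioi]
  exact ENNReal.add_lt_top.2 ⟨h1.lintegral_lt_top, h2.lintegral_lt_top⟩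

lemma kern_sub_comm (H x y : ℝ) : kern H (x - y) = kern H (y - x) := by
  rw [kern, kern, abs_sub_comm]

/-- The covariance kernel is a mixture of products. -/
lemma factorConst_mul_kern (H : ℝ) {s t : ℝ} (hst : s ≠ t) :
    factorConst H * ENNReal.ofReal (kern H (s - t)) =
      ∫⁻ z, factorProfile H (z - s) * factorProfile H (z - t) := by
  wlog h : t < s generalizing s t
  · rw [kern_sub_comm, this hst.symm (lt_of_le_of_ne (not_lt.1 h) hst)]
    exact lintegral_congr fun z => mul_comm _ _
  set c := s - t with hcdef
  have hc : 0 < c := sub_pos.2 h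
  have hm := measurable_factorProfile H
  have h1 : ∫⁻ z, factorProfile H (z - s) * factorProfile H (z - t) =
      ∫⁻ y, factorProfile H y * factorProfile H (y + c) := by
    rw [← lintegral_sub_right_eq_self (fun y => factorProfile H y * factorProfile H (y + c)) s]
    refine lintegral_congr fun z => ?_
    rw [hcdef]
    ring_nf
  have h2 := lintegral_comp_const_mul hc
    (fun y => factorProfile H y * factorProfile H (y + c)) (hm.mul (hm.comp (by fun_prop)))
  -- Homogeneity of the profile: rescaling by the distance `c` gives `c^(2H - 3)`, and the change of
  -- variable supplies the missing power of `c`.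
  have h3 : ∀ x, factorProfile H (c * x) * factorProfile H (c * x + c) =
      ENNReal.ofReal (c ^ (2 * H - 3)) * (factorProfile H x * factorProfile H (x + 1)) := by
    intro x
    rw [show c * x + c = c * (x + 1) by ring, factorProfile_mul hc, factorProfile_mul hc,
      show 2 * H - 3 = (H - 3 / 2) + (H - 3 / 2) by ring, Real.rpow_add hc,
      ENNReal.ofReal_mul (by positivity)]
    ring
  simp only [h3] at h2
  have hm1 : Measurable fun x => factorProfile H x * factorProfile H (x + 1) :=
    hm.mul (hm.comp (by fun_prop))
  rw [lintegral_const_mul _ hm1] at h2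
  have h4 : ENNReal.ofReal (kern H c) = ENNReal.ofReal c * ENNReal.ofReal (c ^ (2 * H - 3)) := by
    rw [← ENNReal.ofReal_mul hc.le, kern, abs_of_pos hc]
    congr 1
    nth_rw 2 [← Real.rpow_one c]
    rw [← Real.rpow_add hc]
    ring_nf
  rw [h1, h4, mul_comm, mul_assoc]
  change _ * (_ * ∫⁻ x, factorProfile H x * factorProfile H (x + 1)) = _
  rw [h2, ← mul_assoc, ← ENNReal.ofReal_mul hc.le, mul_inv_cancel₀ hc.ne', ENNReal.ofReal_one,
    one_mul]

/-! ### The quasi-triangle inequality for the norm -/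

/-- The tensor kernel inherits a factorisation from the one-dimensional kernel, coordinate by
coordinate, with constant `factorConst H ^ n`. -/
lemma tensorNormSq_add_le {H : ℝ} (hH : H ∈ Set.Ioo (1 / 2 : ℝ) 1) (n : ℕ)
    {f g : (Fin n → ℝ) → ℝ≥0∞} (hf : Measurable f) (hg : Measurable g) :
    tensorNormSq H n (fun s => f s + g s) ≤ 2 * tensorNormSq H n f + 2 * tensorNormSq H n g := by
  have hm := measurable_factorProfile H
  simp only [tensorNormSq, restrict_unitCube]
  refine lintegral_quadratic_add_le (ν := (volume : Measure (Fin n → ℝ)))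
    (h := fun s z => ∏ i, factorProfile H (z i - s i)) (C := factorConst H ^ n) ?_ ?_ ?_
    (pow_ne_zero _ (factorConst_ne_zero H hH.2)) (ENNReal.pow_ne_top (factorConst_ne_top hH)) hf hg
  · exact Finset.measurable_prod _ fun i _ => hm.comp (by fun_prop)
  · unfold Function.uncurry
    fun_prop
  · intro s
    have : ∀ᵐ t ∂(cubeMeasure (Fin n)), ∀ i, t i ≠ s i := by
      rw [ae_all_iff]; intro i
      exact Measure.ae_eval_ne _ i _
    filter_upwards [this] with t ht
    have h1 : factorConst H ^ n * ∏ i, ENNReal.ofReal (kern H (s i - t i)) =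
        ∏ i, ∫⁻ z, factorProfile H (z - s i) * factorProfile H (z - t i) := by
      simp only [← factorConst_mul_kern H (ht _).symm, Finset.prod_mul_distrib, Finset.prod_const,
        Finset.card_univ, Fintype.card_fin]
    rw [h1, volume_pi, ← lintegral_fintype_prod
      (f := fun i z => factorProfile H (z - s i) * factorProfile H (z - t i))
      fun i => (hm.comp (by fun_prop)).mul (hm.comp (by fun_prop))]
    simp only [Finset.prod_mul_distrib]

lemma trace_eq_lintegral (H : ℝ) (n j : ℕ) (hj : 2 * j ≤ n) (f : (Fin n → ℝ) → ℝ≥0∞)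
    (u : Fin (n - 2 * j) → ℝ) : trace H n j f u =
      ∫⁻ s, f (Sum.elim u s ∘ (joinEquiv n j hj).symm) * ∏ i : Fin j, ENNReal.ofReal
        (kern H (s ⟨2 * i.1 + 1, by omega⟩ - s ⟨2 * i.1, by omega⟩))
          ∂(cubeMeasure (Fin (2 * j))) := by
  simp only [trace, restrict_unitCube, elim_comp_joinEquiv_symm]

lemma measurable_trace_integrand (H : ℝ) (n j : ℕ) (hj : 2 * j ≤ n) {f : (Fin n → ℝ) → ℝ≥0∞}
    (hf : Measurable f) : Measurable fun p : (Fin (n - 2 * j) → ℝ) × (Fin (2 * j) → ℝ) =>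
      f (Sum.elim p.1 p.2 ∘ (joinEquiv n j hj).symm) * ∏ i : Fin j, ENNReal.ofReal
        (kern H (p.2 ⟨2 * i.1 + 1, by omega⟩ - p.2 ⟨2 * i.1, by omega⟩)) := by
  refine .mul (hf.comp (measurable_elim_comp _ measurable_fst measurable_snd)) ?_
  fun_prop

lemma measurable_trace (H : ℝ) (n j : ℕ) (hj : 2 * j ≤ n) {f : (Fin n → ℝ) → ℝ≥0∞}
    (hf : Measurable f) : Measurable (trace H n j f) := by
  rw [funext (trace_eq_lintegral H n j hj f)]
  exact (measurable_trace_integrand H n j hj hf).lintegral_prod_right'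

lemma trace_add (H : ℝ) (n j : ℕ) (hj : 2 * j ≤ n) {f g : (Fin n → ℝ) → ℝ≥0∞}
    (hf : Measurable f) (u : Fin (n - 2 * j) → ℝ) :
    trace H n j (fun t => f t + g t) u = trace H n j f u + trace H n j g u := by
  simp only [trace_eq_lintegral H n j hj, add_mul]
  exact lintegral_add_left ((measurable_trace_integrand H n j hj hf).comp measurable_prodMk_left) _

lemma trace_mono (H : ℝ) (n j : ℕ) {f g : (Fin n → ℝ) → ℝ≥0∞} (h : ∀ t, f t ≤ g t)
    (u : Fin (n - 2 * j) → ℝ) : trace H n j f u ≤ trace H n j g u :=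
  lintegral_mono fun _ => mul_le_mul_left (h _) _

lemma tensorNormSq_mono (H : ℝ) (n : ℕ) {f g : (Fin n → ℝ) → ℝ≥0∞} (h : ∀ t, f t ≤ g t) :
    tensorNormSq H n f ≤ tensorNormSq H n g :=
  lintegral_mono fun _ => lintegral_mono fun _ => mul_le_mul_left (mul_le_mul' (h _) (h _)) _

/-- The trace is additive and monotone on nonnegative functions, so the quasi-triangle inequality
for tensor norms passes to each term of the sum. -/
lemma stratNormSq_le_of_enorm_le {H : ℝ} (hH : H ∈ Set.Ioo (1 / 2 : ℝ) 1) (n : ℕ)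
    {f a b : (Fin n → ℝ) → ℝ} (ha : Measurable a) (hb : Measurable b)
    (h : ∀ t, ‖f t‖ₑ ≤ ‖a t‖ₑ + ‖b t‖ₑ) :
    stratNormSq H n f ≤ 2 * stratNormSq H n a + 2 * stratNormSq H n b := by
  simp only [stratNormSq]
  rw [Finset.mul_sum, Finset.mul_sum, ← Finset.sum_add_distrib]
  refine Finset.sum_le_sum fun j hj => ?_
  have hj' := two_mul_le_of_mem_range hj
  rw [mul_left_comm 2, mul_left_comm 2, ← mul_add]
  gcongr
  calc _ ≤ tensorNormSq H (n - 2 * j) (fun u =>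
        trace H n j (fun t => ‖a t‖ₑ) u + trace H n j (fun t => ‖b t‖ₑ) u) := by
        refine tensorNormSq_mono _ _ fun u => ?_
        rw [← trace_add H n j hj' ha.enorm]
        exact trace_mono _ _ _ h u
    _ ≤ _ := tensorNormSq_add_le hH _ (measurable_trace H n j hj' ha.enorm)
        (measurable_trace H n j hj' hb.enorm)

/-! ### Inner products of elements of `|ℋ|` -/

/-- The cross term is dominated by the quadratic form of `|f| + |g|`, which the quasi-triangle
inequality bounds by the finite norms of `f` and `g`. -/
lemma integrable_mul_mul_kern {H : ℝ} (hH : H ∈ Set.Ioo (1 / 2 : ℝ) 1) (f g : AbsH H) :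
    Integrable (fun p : ℝ × ℝ => f.1 p.1 * g.1 p.2 * kern H (p.1 - p.2))
      (unitMeasure.prod unitMeasure) := by
  have hm := measurable_factorProfile H
  have hf : Measurable f.1 := f.2.1
  have hg : Measurable g.1 := g.2.1
  have hquad := lintegral_quadratic_add_le (μ := unitMeasure) (ν := (volume : Measure ℝ))
    (h := fun s z => factorProfile H (z - s)) (k := fun s t => ENNReal.ofReal (kern H (s - t)))
    (C := factorConst H) (hm.comp (by fun_prop)) (by unfold Function.uncurry; fun_prop)
    (fun s => by
      filter_upwards [Measure.ae_ne unitMeasure s] with t ht using factorConst_mul_kern H ht.symm)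
    (factorConst_ne_zero H hH.2) (factorConst_ne_top hH) hf.enorm hg.enorm
  have hmeas : Measurable fun p : ℝ × ℝ => f.1 p.1 * g.1 p.2 * kern H (p.1 - p.2) := by fun_prop
  refine ⟨hmeas.aestronglyMeasurable, ?_⟩
  rw [hasFiniteIntegral_iff_enorm, lintegral_prod _ hmeas.enorm.aemeasurable]
  refine lt_of_le_of_lt ?_ (hquad.trans_lt (ENNReal.add_lt_top.2
    ⟨ENNReal.mul_lt_top (by simp) f.2.2, ENNReal.mul_lt_top (by simp) g.2.2⟩))
  gcongr with s t
  rw [enorm_mul, enorm_mul, Real.enorm_of_nonneg (kern_nonneg _ _)]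
  gcongr
  · exact le_self_add
  · exact le_add_self

lemma integral_mul_mul_kern {H : ℝ} (hH : H ∈ Set.Ioo (1 / 2 : ℝ) 1) (f g : AbsH H) :
    ∫ p : ℝ × ℝ, f.1 p.1 * g.1 p.2 * kern H (p.1 - p.2) ∂(unitMeasure.prod unitMeasure) =
      innerH H f.1 g.1 := by
  rw [integral_prod _ (integrable_mul_mul_kern hH f g), innerH]

/-- The family of points whose pairs, for the pairing `e`, are given. -/
noncomputable def pairArrowEquiv (e : ι ⊕ ι ≃ κ) : (ι → ℝ × ℝ) ≃ᵐ (κ → ℝ) :=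
  (MeasurableEquiv.arrowProdEquivProdArrow ℝ ℝ ι).trans
    ((MeasurableEquiv.sumPiEquivProdPi fun _ : ι ⊕ ι => ℝ).symm.trans
      (MeasurableEquiv.piCongrLeft (fun _ : κ => ℝ) e))

lemma pairArrowEquiv_inl (e : ι ⊕ ι ≃ κ) (w : ι → ℝ × ℝ) (p : ι) :
    pairArrowEquiv e w (e (.inl p)) = (w p).1 := by
  simp only [pairArrowEquiv, MeasurableEquiv.trans_apply, MeasurableEquiv.coe_piCongrLeft,
    Equiv.piCongrLeft_apply_apply]
  rfl

lemma pairArrowEquiv_inr (e : ι ⊕ ι ≃ κ) (w : ι → ℝ × ℝ) (p : ι) :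
    pairArrowEquiv e w (e (.inr p)) = (w p).2 := by
  simp only [pairArrowEquiv, MeasurableEquiv.trans_apply, MeasurableEquiv.coe_piCongrLeft,
    Equiv.piCongrLeft_apply_apply]
  rfl

lemma measurePreserving_pairArrowEquiv (e : ι ⊕ ι ≃ κ) :
    MeasurePreserving (pairArrowEquiv e) (Measure.pi fun _ => unitMeasure.prod unitMeasure)
      (cubeMeasure κ) :=
  ((measurePreserving_piCongrLeft (fun _ : κ => unitMeasure) e).comp
    (measurePreserving_sumPiEquivProdPi_symm fun _ : ι ⊕ ι => unitMeasure)).comp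
      (measurePreserving_arrowProdEquivProdArrow ℝ ℝ ι (fun _ => unitMeasure) fun _ => unitMeasure)

lemma prod_mul_pairKernel_pairArrowEquiv {H : ℝ} (e : ι ⊕ ι ≃ κ) (h : κ → AbsH H)
    (w : ι → ℝ × ℝ) :
    (∏ q, (h q).1 (pairArrowEquiv e w q)) * pairKernel H e (pairArrowEquiv e w) =
      ∏ p, (h (e (.inl p))).1 (w p).1 * (h (e (.inr p))).1 (w p).2 *
        kern H ((w p).1 - (w p).2) := by
  rw [← Equiv.prod_comp e, Fintype.prod_sum_type, pairKernel, ← Finset.prod_mul_distrib,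
    ← Finset.prod_mul_distrib]
  simp only [pairArrowEquiv_inl, pairArrowEquiv_inr]

lemma integrable_prod_mul_pairKernel {H : ℝ} (hH : H ∈ Set.Ioo (1 / 2 : ℝ) 1) (e : ι ⊕ ι ≃ κ)
    (h : κ → AbsH H) :
    Integrable (fun z => (∏ q, (h q).1 (z q)) * pairKernel H e z) (cubeMeasure κ) := by
  rw [← (measurePreserving_pairArrowEquiv e).integrable_comp_emb
    (MeasurableEquiv.measurableEmbedding _)]
  simp only [Function.comp_def, prod_mul_pairKernel_pairArrowEquiv]
  exact Integrable.fintype_prod fun p => integrable_mul_mul_kern hH _ _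

/-- Grouping the points by pairs makes the integrand a product over independent pairs, each
contributing one inner product. -/
lemma integral_prod_mul_pairKernel {H : ℝ} (hH : H ∈ Set.Ioo (1 / 2 : ℝ) 1) (e : ι ⊕ ι ≃ κ)
    (h : κ → AbsH H) :
    ∫ z, (∏ q, (h q).1 (z q)) * pairKernel H e z ∂(cubeMeasure κ) =
      ∏ p, innerH H (h (e (.inl p))).1 (h (e (.inr p))).1 := by
  rw [← (measurePreserving_pairArrowEquiv e).integral_comp']
  simp only [prod_mul_pairKernel_pairArrowEquiv, ← integral_mul_mul_kern hH]
  exact integral_fintype_prod_eq_prod (𝕜 := ℝ) fun p (x : ℝ × ℝ) =>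
    (h (e (.inl p))).1 x.1 * (h (e (.inr p))).1 x.2 * kern H (x.1 - x.2)

/-! ### The second moment of the multiple Stratonovich integral -/

lemma measurable_tensorSum {H : ℝ} (n : ℕ) (c : AbsH H →₀ ℝ) : Measurable (tensorSum n c) := by
  unfold tensorSum Finsupp.sum
  exact Finset.measurable_sum _ fun g _ => (Finset.measurable_prod _ fun i _ =>
    g.2.1.comp (measurable_pi_apply i)).const_mul _

lemma integrable_prod_prod_pairKernel {H : ℝ} (hH : H ∈ Set.Ioo (1 / 2 : ℝ) 1) {n : ℕ}
    (e : ι ⊕ ι ≃ Fin n ⊕ Fin n) (f g : AbsH H) :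
    Integrable (fun z => (∏ i, f.1 (z (.inl i))) * (∏ i, g.1 (z (.inr i))) * pairKernel H e z)
      (cubeMeasure (Fin n ⊕ Fin n)) := by
  have := integrable_prod_mul_pairKernel hH e (Sum.elim (fun _ => f) fun _ => g)
  simpa only [Fintype.prod_sum_type, Sum.elim_inl, Sum.elim_inr] using this

lemma integral_prod_prod_pairEquiv {H : ℝ} (hH : H ∈ Set.Ioo (1 / 2 : ℝ) 1) {n j : ℕ}
    (hj : 2 * j ≤ n) (f g : AbsH H) :
    ∫ z, (∏ i, f.1 (z (.inl i))) * (∏ i, g.1 (z (.inr i))) * pairKernel H (pairEquiv n j hj) z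
      ∂(cubeMeasure (Fin n ⊕ Fin n)) =
      innerH H f.1 f.1 ^ j * innerH H g.1 g.1 ^ j * innerH H f.1 g.1 ^ (n - 2 * j) := by
  have := integral_prod_mul_pairKernel hH (pairEquiv n j hj) (Sum.elim (fun _ => f) fun _ => g)
  simp only [Fintype.prod_sum_type, Sum.elim_inl, Sum.elim_inr] at this
  rw [this]
  simp only [pairEquiv, Equiv.ofBijective_apply, pairFun, Sum.elim_inl, Sum.elim_inr,
    Finset.prod_const, Finset.card_univ, Fintype.card_fin]
  ring

section Moment

variable {Ω : Type*} [MeasurableSpace Ω] {P : Measure Ω} [IsProbabilityMeasure P] {H : ℝ}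
  {W : AbsH H → Ω → ℝ}

lemma integral_pow_mul_pow_isonormal (hW : IsIsonormal P H W) (f g : AbsH H) (n : ℕ) :
    ∫ ω, W f ω ^ n * W g ω ^ n ∂P = ∑ j : Finset.range (n / 2 + 1), stratCoef n j *
      (innerH H f.1 f.1 ^ (j : ℕ) * innerH H g.1 g.1 ^ (j : ℕ) *
        innerH H f.1 g.1 ^ (n - 2 * j)) := by
  rw [integral_pow_mul_pow (hW.gaussian.hasGaussianLaw_prodMk) (hW.centred f) (hW.centred g),
    ← Finset.sum_coe_sort]
  simp only [hW.covariance]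

lemma integrable_stratSum_sq (hW : IsIsonormal P H W) (n : ℕ) (c : AbsH H →₀ ℝ) :
    Integrable (fun ω => stratSum W n c ω * stratSum W n c ω) P := by
  simp only [stratSum, Finsupp.sum, Finset.sum_mul_sum]
  refine integrable_finsetSum _ fun f _ => integrable_finsetSum _ fun g _ => ?_
  have := (integrable_pow_mul_pow (hW.gaussian.hasGaussianLaw_eval f)
    (hW.gaussian.hasGaussianLaw_eval g) n n).const_mul (c f * c g)
  exact this.congr (.of_forall fun ω => by ring)

/-- Both sides are quadratic in the coefficients, so it suffices to compare pairs `(f, g)`: the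
Gaussian mixed moment on the left matches the factorised paired integral on the right. -/
lemma integral_stratSum_sq (hH : H ∈ Set.Ioo (1 / 2 : ℝ) 1) (hW : IsIsonormal P H W) (n : ℕ)
    (c : AbsH H →₀ ℝ) :
    ∫ ω, stratSum W n c ω * stratSum W n c ω ∂P = ∑ j : Finset.range (n / 2 + 1), stratCoef n j *
      ∫ z, tensorSum n c (z ∘ Sum.inl) * tensorSum n c (z ∘ Sum.inr) *
        pairKernel H (pairEquiv n j (two_mul_le_of_mem_range j.2)) z
          ∂(cubeMeasure (Fin n ⊕ Fin n)) := by
  have hL : ∫ ω, stratSum W n c ω * stratSum W n c ω ∂P =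
      ∑ f ∈ c.support, ∑ g ∈ c.support, c f * c g * ∫ ω, W f ω ^ n * W g ω ^ n ∂P := by
    have hi : ∀ f g : AbsH H, Integrable (fun ω => c f * c g * (W f ω ^ n * W g ω ^ n)) P :=
      fun f g => (integrable_pow_mul_pow (hW.gaussian.hasGaussianLaw_eval f)
        (hW.gaussian.hasGaussianLaw_eval g) n n).const_mul _
    have h1 : ∀ ω, stratSum W n c ω * stratSum W n c ω =
        ∑ f ∈ c.support, ∑ g ∈ c.support, c f * c g * (W f ω ^ n * W g ω ^ n) := by
      intro ω
      simp only [stratSum, Finsupp.sum, Finset.sum_mul_sum]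
      exact Finset.sum_congr rfl fun f _ => Finset.sum_congr rfl fun g _ => by ring
    simp only [h1]
    rw [integral_finsetSum _ fun f _ => integrable_finsetSum _ fun g _ => hi f g]
    refine Finset.sum_congr rfl fun f _ => ?_
    rw [integral_finsetSum _ fun g _ => hi f g]
    exact Finset.sum_congr rfl fun g _ => integral_const_mul _ _
  have hR : ∀ j : Finset.range (n / 2 + 1),
      ∫ z, tensorSum n c (z ∘ Sum.inl) * tensorSum n c (z ∘ Sum.inr) *
        pairKernel H (pairEquiv n j (two_mul_le_of_mem_range j.2)) z
          ∂(cubeMeasure (Fin n ⊕ Fin n)) =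
      ∑ f ∈ c.support, ∑ g ∈ c.support, c f * c g *
        (innerH H f.1 f.1 ^ (j : ℕ) * innerH H g.1 g.1 ^ (j : ℕ) *
          innerH H f.1 g.1 ^ (n - 2 * j)) := by
    intro j
    have hj := two_mul_le_of_mem_range j.2
    have hi : ∀ f g : AbsH H, Integrable (fun z => c f * c g * ((∏ i, f.1 (z (.inl i))) *
        (∏ i, g.1 (z (.inr i))) * pairKernel H (pairEquiv n j hj) z))
          (cubeMeasure (Fin n ⊕ Fin n)) :=
      fun f g => (integrable_prod_prod_pairKernel hH (pairEquiv n j hj) f g).const_mul _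
    have h1 : ∀ z, tensorSum n c (z ∘ Sum.inl) * tensorSum n c (z ∘ Sum.inr) *
        pairKernel H (pairEquiv n j hj) z =
        ∑ f ∈ c.support, ∑ g ∈ c.support, c f * c g * ((∏ i, f.1 (z (.inl i))) *
        (∏ i, g.1 (z (.inr i))) * pairKernel H (pairEquiv n j hj) z) := by
      intro z
      simp only [tensorSum, Finsupp.sum, Function.comp]
      rw [Finset.sum_mul_sum, Finset.sum_mul]
      refine Finset.sum_congr rfl fun f _ => ?_
      rw [Finset.sum_mul]
      exact Finset.sum_congr rfl fun g _ => by ring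
    simp only [h1]
    rw [integral_finsetSum _ fun f _ => integrable_finsetSum _ fun g _ => hi f g]
    refine Finset.sum_congr rfl fun f _ => ?_
    rw [integral_finsetSum _ fun g _ => hi f g]
    refine Finset.sum_congr rfl fun g _ => ?_
    rw [integral_const_mul, integral_prod_prod_pairEquiv hH hj]
  rw [hL]
  simp only [hR, integral_pow_mul_pow_isonormal hW, Finset.mul_sum]
  conv_rhs => rw [Finset.sum_comm]
  refine Finset.sum_congr rfl fun f _ => ?_
  conv_rhs => rw [Finset.sum_comm]
  refine Finset.sum_congr rfl fun g _ => Finset.sum_congr rfl fun j _ => ?_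
  ring

lemma aestronglyMeasurable_stratSum (hW : IsIsonormal P H W) (n : ℕ) (c : AbsH H →₀ ℝ) :
    AEStronglyMeasurable (stratSum W n c) P := by
  have h : ∀ g, AEMeasurable (W g) P := fun g => (hW.gaussian.hasGaussianLaw_eval g).aemeasurable
  unfold stratSum Finsupp.sum
  exact (Finset.aemeasurable_fun_sum _ fun g _ =>
    ((h g).pow_const n).const_mul (c g)).aestronglyMeasurable

/-- The norm controls the second moment of the multiple Stratonovich integral. -/
lemma eLpNorm_stratSum_sq_le (hH : H ∈ Set.Ioo (1 / 2 : ℝ) 1) (hW : IsIsonormal P H W) (n : ℕ)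
    (c : AbsH H →₀ ℝ) : eLpNorm (stratSum W n c) 2 P ^ 2 ≤ stratNormSq H n (tensorSum n c) := by
  have h1 : eLpNorm (stratSum W n c) 2 P ^ 2 =
      ENNReal.ofReal (∫ ω, stratSum W n c ω * stratSum W n c ω ∂P) := by
    rw [ofReal_integral_eq_lintegral_ofReal (integrable_stratSum_sq hW n c)
      (.of_forall fun ω => mul_self_nonneg _),
      eLpNorm_eq_lintegral_rpow_enorm_toReal (by norm_num) (by norm_num), ← ENNReal.rpow_natCast,
      ← ENNReal.rpow_mul]
    simp only [ENNReal.toReal_ofNat, Nat.cast_ofNat, one_div, isUnit_iff_ne_zero, ne_eq,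
      OfNat.ofNat_ne_zero, not_false_eq_true, IsUnit.inv_mul_cancel, ENNReal.rpow_one]
    refine lintegral_congr fun ω => ?_
    rw [← abs_mul_abs_self, ENNReal.ofReal_mul (abs_nonneg _), ← Real.enorm_eq_ofReal_abs, ← sq]
    exact ENNReal.rpow_natCast _ 2
  rw [h1, integral_stratSum_sq hH hW, stratNormSq_eq _ _ _ (measurable_tensorSum n c)]
  let I : Finset.range (n / 2 + 1) → ℝ := fun j =>
    ∫ z, tensorSum n c (z ∘ Sum.inl) * tensorSum n c (z ∘ Sum.inr) *
      pairKernel H (pairEquiv n j (two_mul_le_of_mem_range j.2)) z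
        ∂(cubeMeasure (Fin n ⊕ Fin n))
  have hI : ∑ j : Finset.range (n / 2 + 1), stratCoef n j * I j ≤
      ∑ j : Finset.range (n / 2 + 1), stratCoef n j * |I j| :=
    Finset.sum_le_sum fun j _ =>
      mul_le_mul_of_nonneg_left (le_abs_self _) (stratCoef_pos n j).le
  refine (ENNReal.ofReal_le_ofReal hI).trans ?_
  rw [ENNReal.ofReal_sum_of_nonneg (f := fun j : Finset.range (n / 2 + 1) => stratCoef n j * |I j|)
    fun j _ => mul_nonneg (stratCoef_pos n j).le (abs_nonneg _)]
  refine Finset.sum_le_sum fun j _ => ?_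
  rw [ENNReal.ofReal_mul (stratCoef_pos n j).le, ← Real.enorm_eq_ofReal_abs]
  gcongr
  refine (enorm_integral_le_lintegral_enorm _).trans_eq (lintegral_congr fun z => ?_)
  rw [enorm_mul, enorm_mul, Real.enorm_of_nonneg (pairKernel_nonneg _ _ _)]

end Moment

/-! ### Bounded functions in `|ℋ|`, and control of the norm by an `L^p` norm -/

lemma lintegral_kern_le {H : ℝ} (hH : 1 / 2 < H) :
    ∃ C : ℝ≥0∞, C < ∞ ∧ ∀ s ∈ Set.Icc (0 : ℝ) 1,
      ∫⁻ t, ENNReal.ofReal (kern H (s - t)) ∂unitMeasure ≤ C := by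
  set G : ℝ → ℝ≥0∞ := (Set.Ioc 0 1).indicator fun x => ENNReal.ofReal (x ^ (2 * H - 2)) with hG
  have hGm : Measurable G := Measurable.indicator (by fun_prop) measurableSet_Ioc
  have hGfin : ∫⁻ x, G x < ∞ := by
    rw [hG, lintegral_indicator measurableSet_Ioc]
    exact ((intervalIntegrable_iff_integrableOn_Ioc_of_le zero_le_one).1
      (intervalIntegral.intervalIntegrable_rpow' (by linarith))).lintegral_lt_top
  refine ⟨(∫⁻ x, G x) + ∫⁻ x, G x, ENNReal.add_lt_top.2 ⟨hGfin, hGfin⟩, fun s hs => ?_⟩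
  calc ∫⁻ t, ENNReal.ofReal (kern H (s - t)) ∂unitMeasure
      ≤ ∫⁻ t, (G (t - s) + G (s - t)) ∂unitMeasure := by
        refine lintegral_mono_ae ?_
        filter_upwards [ae_restrict_mem measurableSet_Icc, Measure.ae_ne unitMeasure s]
          with t ht hts
        rcases lt_or_gt_of_ne hts with h | h
        · refine le_add_left (le_of_eq ?_)
          have hmem : s - t ∈ Set.Ioc (0 : ℝ) 1 := ⟨sub_pos.2 h, by linarith [hs.2, ht.1]⟩
          rw [hG, Set.indicator_of_mem hmem, kern,
            abs_of_pos (sub_pos.2 h)]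
        · refine le_add_right (le_of_eq ?_)
          have hmem : t - s ∈ Set.Ioc (0 : ℝ) 1 := ⟨sub_pos.2 h, by linarith [ht.2, hs.1]⟩
          rw [hG, Set.indicator_of_mem hmem, kern,
            abs_sub_comm, abs_of_pos (sub_pos.2 h)]
    _ ≤ ∫⁻ t, (G (t - s) + G (s - t)) := setLIntegral_le_lintegral _ _
    _ = _ := by
        have hm : Measurable fun t => G (t - s) := hGm.comp (by fun_prop)
        rw [lintegral_add_left hm,
          lintegral_sub_right_eq_self G s, lintegral_sub_left_eq_self G s]

/-- A measurable function that is bounded on `[0,1]`, as an element of `|ℋ|`. -/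
noncomputable def AbsH.ofBounded {H : ℝ} (hH : 1 / 2 < H) (f : ℝ → ℝ) (hf : Measurable f)
    (hb : ∃ M : ℝ≥0, ∀ x ∈ Set.Icc (0 : ℝ) 1, ‖f x‖ₑ ≤ M) : AbsH H :=
  ⟨f, hf, by
    obtain ⟨M, hM⟩ := hb
    obtain ⟨C, hC, hle⟩ := lintegral_kern_le hH
    calc _ ≤ ∫⁻ _s in Set.Icc (0 : ℝ) 1, M * M * C := by
          refine setLIntegral_mono' measurableSet_Icc fun s hs => ?_
          calc _ ≤ ∫⁻ t in Set.Icc (0 : ℝ) 1, M * M * ENNReal.ofReal (kern H (s - t)) := by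
                refine setLIntegral_mono' measurableSet_Icc fun t ht => ?_
                gcongr
                · exact hM s hs
                · exact hM t ht
            _ = M * M * ∫⁻ t in Set.Icc (0 : ℝ) 1, ENNReal.ofReal (kern H (s - t)) :=
                lintegral_const_mul _ (by fun_prop)
            _ ≤ _ := by gcongr; exact hle s hs
      _ < ∞ := by
          simp only [lintegral_const, MeasurableSet.univ, Measure.restrict_apply, Set.univ_inter,
            Real.volume_Icc]
          exact ENNReal.mul_lt_top (ENNReal.mul_lt_top (ENNReal.mul_lt_top
            ENNReal.coe_lt_top ENNReal.coe_lt_top) hC) ENNReal.ofReal_lt_top⟩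

lemma lintegral_pairKernel_lt_top {H : ℝ} (hH : H ∈ Set.Ioo (1 / 2 : ℝ) 1) (e : ι ⊕ ι ≃ κ) :
    ∫⁻ z, ENNReal.ofReal (pairKernel H e z) ∂(cubeMeasure κ) < ∞ := by
  have := integrable_prod_mul_pairKernel hH e fun _ =>
    AbsH.ofBounded hH.1 (fun _ => 1) measurable_const ⟨1, by simp⟩
  simp only [AbsH.ofBounded, Finset.prod_const_one, one_mul] at this
  exact this.lintegral_lt_top

lemma pairKernel_rpow {σ : Type*} {H H' q : ℝ} (hq : (2 * H - 2) * q = 2 * H' - 2)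
    (e : ι ⊕ ι → σ) (z : σ → ℝ) : pairKernel H e z ^ q = pairKernel H' e z := by
  rw [pairKernel, pairKernel, ← Real.finsetProd_rpow _ _ fun _ _ => kern_nonneg _ _]
  refine Finset.prod_congr rfl fun p _ => ?_
  rw [kern, kern, ← Real.rpow_mul (abs_nonneg _), hq]

/-- The norm is controlled by an `L^p` norm, for a large `p`. -/
lemma exists_stratNormSq_le_lintegral_rpow {H : ℝ} (hH : H ∈ Set.Ioo (1 / 2 : ℝ) 1) (n : ℕ) :
    ∃ p : ℝ, 1 < p ∧ ∃ C : ℝ≥0∞, C ≠ ∞ ∧ ∀ f : (Fin n → ℝ) → ℝ, Measurable f →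
      stratNormSq H n f ≤ C * ((∫⁻ x, ‖f x‖ₑ ^ p ∂(cubeMeasure (Fin n))) ^ 2) ^ (1 / p) := by
  obtain ⟨hH1, hH2⟩ := hH
  -- The midpoint of `1/2` and `H`: a power `q > 1` of the kernel for `H` is the kernel for `H'`,
  -- still integrable since `H' > 1/2`. Hölder's inequality then leaves an `L^p` norm of `f`, `p`
  -- conjugate to `q`.
  set H' := (H + 1 / 2) / 2 with hH'
  have hH'mem : H' ∈ Set.Ioo (1 / 2 : ℝ) 1 := ⟨by linarith, by linarith⟩
  set q := (2 - 2 * H') / (2 - 2 * H) with hq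
  have hq1 : 1 < q := by
    rw [hq, one_lt_div (by linarith)]
    linarith
  have hqq : (2 * H - 2) * q = 2 * H' - 2 := by
    rw [hq]
    have : 2 - 2 * H ≠ 0 := by linarith
    field_simp
    ring
  have hconj := (Real.HolderConjugate.conjExponent hq1).symm
  set p := Real.conjExponent q
  refine ⟨p, hconj.lt, ∑ j : Finset.range (n / 2 + 1), ENNReal.ofReal (stratCoef n j) *
    (∫⁻ z, ENNReal.ofReal (pairKernel H' (pairEquiv n j (two_mul_le_of_mem_range j.2)) z)
      ∂(cubeMeasure (Fin n ⊕ Fin n))) ^ (1 / q), ?_, fun f hf => ?_⟩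
  · refine (ENNReal.sum_lt_top.2 fun j _ => ENNReal.mul_lt_top ENNReal.ofReal_lt_top ?_).ne
    exact ENNReal.rpow_lt_top_of_nonneg (by positivity) (lintegral_pairKernel_lt_top hH'mem _).ne
  · rw [stratNormSq_eq _ _ _ hf, Finset.sum_mul]
    refine Finset.sum_le_sum fun j _ => ?_
    rw [mul_assoc]
    gcongr
    have hff : Measurable fun z : Fin n ⊕ Fin n → ℝ => ‖f (z ∘ Sum.inl)‖ₑ * ‖f (z ∘ Sum.inr)‖ₑ :=
      (hf.comp (by fun_prop)).enorm.mul (hf.comp (by fun_prop)).enorm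
    refine (ENNReal.lintegral_mul_le_Lp_mul_Lq (cubeMeasure (Fin n ⊕ Fin n)) hconj
      hff.aemeasurable (g := fun z => ENNReal.ofReal
        (pairKernel H (pairEquiv n j (two_mul_le_of_mem_range j.2)) z))
      (by fun_prop)).trans_eq ?_
    have h1 : ∫⁻ z, (‖f (z ∘ Sum.inl)‖ₑ * ‖f (z ∘ Sum.inr)‖ₑ) ^ p
        ∂(cubeMeasure (Fin n ⊕ Fin n)) = (∫⁻ x, ‖f x‖ₑ ^ p ∂(cubeMeasure (Fin n))) ^ 2 := by
      have hfp : Measurable fun x => ‖f x‖ₑ ^ p := hf.enorm.pow_const p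
      rw [lintegral_pi_sum _ _ (hff.pow_const p)]
      simp only [Sum.elim_comp_inl, Sum.elim_comp_inr, ENNReal.mul_rpow_of_nonneg _ _ hconj.nonneg]
      have h2 : ∀ x, ∫⁻ y, ‖f x‖ₑ ^ p * ‖f y‖ₑ ^ p ∂(cubeMeasure (Fin n)) =
          ‖f x‖ₑ ^ p * ∫⁻ y, ‖f y‖ₑ ^ p ∂(cubeMeasure (Fin n)) :=
        fun x => lintegral_const_mul _ hfp
      simp only [h2]
      rw [lintegral_mul_const _ hfp, sq]
    rw [h1, mul_comm]
    congr 2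
    refine lintegral_congr fun z => ?_
    rw [ENNReal.ofReal_rpow_of_nonneg (pairKernel_nonneg _ _ _) (by linarith), pairKernel_rpow hqq]

/-! ### Truncation -/

lemma lintegral_lt_top_of_stratNormSq_lt_top {H : ℝ} {n : ℕ} {f : (Fin n → ℝ) → ℝ}
    (hf : Measurable f) (hfin : stratNormSq H n f < ∞) (j : Finset.range (n / 2 + 1)) :
    ∫⁻ z, ‖f (z ∘ Sum.inl)‖ₑ * ‖f (z ∘ Sum.inr)‖ₑ *
        ENNReal.ofReal (pairKernel H (pairEquiv n j (two_mul_le_of_mem_range j.2)) z)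
          ∂(cubeMeasure (Fin n ⊕ Fin n)) < ∞ := by
  rw [stratNormSq_eq _ _ _ hf, ENNReal.sum_lt_top] at hfin
  refine ENNReal.lt_top_of_mul_ne_top_right (hfin j (Finset.mem_univ _)).ne ?_
  exact (ENNReal.ofReal_pos.2 (stratCoef_pos n j)).ne'

/-- The function `f`, where it is bounded by `M`, and `0` elsewhere. -/
noncomputable def truncate {X : Type*} (M : ℝ) (f : X → ℝ) (x : X) : ℝ :=
  if |f x| ≤ M then f x else 0

lemma measurable_truncate {X : Type*} [MeasurableSpace X] (M : ℝ) {f : X → ℝ} (hf : Measurable f) :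
    Measurable (truncate M f) :=
  Measurable.ite (measurableSet_le hf.abs measurable_const) hf measurable_const

lemma abs_truncate_le {X : Type*} {M : ℝ} (hM : 0 ≤ M) (f : X → ℝ) (x : X) :
    |truncate M f x| ≤ M := by
  unfold truncate
  split_ifs with h
  · exact h
  · simpa using hM

lemma enorm_sub_truncate_le {X : Type*} (M : ℝ) (f : X → ℝ) (x : X) :
    ‖f x - truncate M f x‖ₑ ≤ ‖f x‖ₑ := by
  unfold truncate
  split_ifs with h <;> simp

/-- Dominated convergence in each term of the norm: the integrand of `f` itself dominates, and at
each point the remainder vanishes once the level is large. -/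
lemma tendsto_stratNormSq_sub_truncate {H : ℝ} {n : ℕ} {f : (Fin n → ℝ) → ℝ} (hf : Measurable f)
    (hfin : stratNormSq H n f < ∞) :
    Tendsto (fun M : ℕ => stratNormSq H n fun t => f t - truncate M f t) atTop (𝓝 0) := by
  have hm : ∀ M : ℕ, Measurable fun t => f t - truncate M f t :=
    fun M => hf.sub (measurable_truncate M hf)
  simp only [stratNormSq_eq _ _ _ (hm _)]
  rw [← Finset.sum_const_zero (s := Finset.univ (α := Finset.range (n / 2 + 1)))]
  refine tendsto_finsetSum _ fun j _ => ?_
  rw [← mul_zero (ENNReal.ofReal (stratCoef n j))]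
  refine ENNReal.Tendsto.const_mul ?_ (Or.inr ENNReal.ofReal_ne_top)
  rw [← lintegral_zero (μ := cubeMeasure (Fin n ⊕ Fin n))]
  refine tendsto_lintegral_of_dominated_convergence
    (fun z => ‖f (z ∘ Sum.inl)‖ₑ * ‖f (z ∘ Sum.inr)‖ₑ *
      ENNReal.ofReal (pairKernel H (pairEquiv n j (two_mul_le_of_mem_range j.2)) z))
    (fun M => ?_) (fun M => .of_forall fun z => ?_)
    (lintegral_lt_top_of_stratNormSq_lt_top hf hfin j).ne (.of_forall fun z => ?_)
  · exact (((hm M).comp (by fun_prop)).enorm.mul ((hm M).comp (by fun_prop)).enorm).mul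
      (by fun_prop)
  · simp only
    gcongr <;> exact enorm_sub_truncate_le _ _ _
  · obtain ⟨M, hM⟩ := exists_nat_ge |f (z ∘ Sum.inl)|
    refine tendsto_const_nhds.congr' ?_
    filter_upwards [eventually_ge_atTop M] with N hN
    have : |f (z ∘ Sum.inl)| ≤ N := hM.trans (by exact_mod_cast hN)
    simp [truncate, this]

/-! ### Density of the finite sums of powers -/

lemma tensorSum_eq_linearCombination {H : ℝ} (n : ℕ) (c : AbsH H →₀ ℝ) :
    tensorSum n c =
      Finsupp.linearCombination ℝ (fun (g : AbsH H) (t : Fin n → ℝ) => ∏ i, g.1 (t i)) c := by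
  ext t
  simp [tensorSum, Finsupp.linearCombination_apply, Finsupp.sum, Finset.sum_apply]

lemma tensorSum_sub {H : ℝ} (n : ℕ) (c d : AbsH H →₀ ℝ) (t : Fin n → ℝ) :
    tensorSum n (c - d) t = tensorSum n c t - tensorSum n d t := by
  simp only [tensorSum_eq_linearCombination, map_sub, Pi.sub_apply]

lemma tensorSum_comp_perm {H : ℝ} (n : ℕ) (c : AbsH H →₀ ℝ) (t : Fin n → ℝ)
    (σ : Equiv.Perm (Fin n)) : tensorSum n c (t ∘ σ) = tensorSum n c t := by
  simp only [tensorSum, Function.comp]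
  congr 1
  ext g a
  rw [Equiv.prod_comp σ fun i => g.1 (t i)]

/-- Increasing tuples in the unit cube. -/
def orderedCube (n : ℕ) : Set (Fin n → ℝ) := unitCube n ∩ {t | Monotone t}

lemma isClosed_monotone (n : ℕ) : IsClosed {t : Fin n → ℝ | Monotone t} := by
  simp only [Monotone, Set.ofPred_forall]
  exact isClosed_iInter fun i => isClosed_iInter fun j => isClosed_iInter fun _ =>
    isClosed_le (continuous_apply i) (continuous_apply j)

lemma isCompact_orderedCube (n : ℕ) : IsCompact (orderedCube n) :=
  isCompact_Icc.inter_right (isClosed_monotone n)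

/-- The function `t ↦ ∏ i, p (t i)` of a polynomial `p`. -/
noncomputable def polyTensor (n : ℕ) : Polynomial ℝ →* C(orderedCube n, ℝ) where
  toFun p := ⟨fun t => ∏ i, p.eval (t.1 i), by
    refine continuous_finsetProd _ fun i _ => p.continuous.comp ?_
    exact (continuous_apply i).comp continuous_subtype_val⟩
  map_one' := by ext; simp
  map_mul' p q := by ext; simp [Finset.prod_mul_distrib]

/-- Testing with `a - X` for all `a` shows that the monic polynomials with roots `x` and `y`
coincide, hence so do the multisets of roots; sorted lists are determined by their multisets. -/
lemma eq_of_prod_eval_eq {n : ℕ} {x y : Fin n → ℝ} (hx : Monotone x) (hy : Monotone y)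
    (h : ∀ p : Polynomial ℝ, ∏ i, p.eval (x i) = ∏ i, p.eval (y i)) : x = y := by
  have h1 : ∀ x : Fin n → ℝ,
      ((Finset.univ.val.map x).map fun a => Polynomial.X - Polynomial.C a).prod =
      ∏ i, (Polynomial.X - Polynomial.C (x i)) := by
    intro x
    rw [Multiset.map_map]
    rfl
  have h2 : ∏ i, (Polynomial.X - Polynomial.C (x i)) =
      ∏ i, (Polynomial.X - Polynomial.C (y i)) := by
    refine Polynomial.funext fun a => ?_
    have h3 : ∀ b : ℝ, (Polynomial.C a - Polynomial.X).eval b = a - b := fun b => by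
      rw [Polynomial.eval_sub, Polynomial.eval_C, Polynomial.eval_X]
    have h4 := h (Polynomial.C a - Polynomial.X)
    simp only [h3] at h4
    simpa only [Polynomial.eval_prod, Polynomial.eval_sub, Polynomial.eval_X, Polynomial.eval_C]
      using h4
  have h3 : Finset.univ.val.map x = Finset.univ.val.map y := by
    rw [← Polynomial.roots_multiset_prod_X_sub_C (Finset.univ.val.map x), h1, h2, ← h1,
      Polynomial.roots_multiset_prod_X_sub_C]
  rw [Fin.univ_val_map, Fin.univ_val_map, Multiset.coe_eq_coe] at h3
  exact List.ofFn_injective (h3.eq_of_sortedLE hx.sortedLE_ofFn hy.sortedLE_ofFn)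

/-- A polynomial as an element of `|ℋ|`. -/
noncomputable def AbsH.ofPolynomial {H : ℝ} (hH : 1 / 2 < H) (p : Polynomial ℝ) : AbsH H :=
  AbsH.ofBounded hH (fun x => p.eval x) p.continuous.measurable (by
    obtain ⟨M, hM⟩ := isCompact_Icc.exists_bound_of_continuousOn (s := Set.Icc (0 : ℝ) 1)
      p.continuous.continuousOn
    refine ⟨M.toNNReal, fun x hx => ?_⟩
    rw [← ofReal_norm]
    exact ENNReal.ofReal_le_ofReal (hM x hx))

/-- Finite sums of powers are uniformly dense in the continuous functions of increasing tuples. -/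
lemma exists_tensorSum_near {H : ℝ} (hH : 1 / 2 < H) (n : ℕ) {g : (Fin n → ℝ) → ℝ}
    (hg : Continuous g) {δ : ℝ} (hδ : 0 < δ) :
    ∃ c : AbsH H →₀ ℝ, ∀ t ∈ orderedCube n, |g t - tensorSum n c t| < δ := by
  have := isCompact_iff_compactSpace.1 (isCompact_orderedCube n)
  -- Stone–Weierstrass on increasing tuples: powers `p^{⊗ n}` are symmetric, so they can separate
  -- points only after one ordering has been fixed.
  obtain ⟨⟨k, hk⟩, hkg⟩ :=
    ContinuousMap.exists_mem_subalgebra_near_continuous_of_separatesPoints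
      (Algebra.adjoin ℝ (Set.range (polyTensor n))) (by
        intro x y hxy
        by_contra! hcon
        refine hxy (Subtype.ext (eq_of_prod_eval_eq x.2.2 y.2.2 fun p => ?_))
        exact hcon _ ⟨polyTensor n p, Algebra.subset_adjoin ⟨p, rfl⟩, rfl⟩)
      (fun t => g t) (hg.comp continuous_subtype_val) δ hδ
  have hspan : ∃ c : AbsH H →₀ ℝ, ∀ t : orderedCube n, k t = tensorSum n c t := by
    have hk' : k ∈ Subalgebra.toSubmodule (Algebra.adjoin ℝ (Set.range (polyTensor n))) := hk
    -- The powers are closed under multiplication, so the algebra they generate is their linear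
    -- span.
    rw [Algebra.adjoin_eq_span, ← MonoidHom.coe_mrange, Submonoid.closure_eq] at hk'
    clear hk hkg
    induction hk' using Submodule.span_induction with
    | mem k h =>
      obtain ⟨p, rfl⟩ := h
      refine ⟨Finsupp.single (AbsH.ofPolynomial hH p) 1, fun t => ?_⟩
      simp only [tensorSum_eq_linearCombination, Finsupp.linearCombination_single, one_smul]
      rfl
    | zero => exact ⟨0, fun t => by simp [tensorSum]⟩
    | add k l _ _ hk hl =>
      obtain ⟨c, hc⟩ := hk
      obtain ⟨d, hd⟩ := hl
      refine ⟨c + d, fun t => ?_⟩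
      rw [ContinuousMap.add_apply, hc, hd]
      simp only [tensorSum_eq_linearCombination, map_add, Pi.add_apply]
    | smul a k _ hk =>
      obtain ⟨c, hc⟩ := hk
      refine ⟨a • c, fun t => ?_⟩
      rw [ContinuousMap.smul_apply, hc]
      simp only [tensorSum_eq_linearCombination, map_smul, Pi.smul_apply]
  obtain ⟨c, hc⟩ := hspan
  refine ⟨c, fun t ht => ?_⟩
  have := hkg ⟨t, ht⟩
  rw [Real.norm_eq_abs, abs_sub_comm] at this
  rw [← hc ⟨t, ht⟩]
  exact this

/-- Every tuple is a rearrangement of an increasing one, and rearranging preserves the measure; ties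
only matter for equality, which is not needed. -/
lemma lintegral_le_factorial_mul_lintegral_monotone {n : ℕ} {F : (Fin n → ℝ) → ℝ≥0∞}
    (hF : Measurable F) (hs : ∀ t (σ : Equiv.Perm (Fin n)), F (t ∘ σ) = F t) :
    ∫⁻ t, F t ∂(cubeMeasure (Fin n)) ≤
      n ! * ∫⁻ t in {t | Monotone t}, F t ∂(cubeMeasure (Fin n)) := by
  have hm : MeasurableSet {t : Fin n → ℝ | Monotone t} := (isClosed_monotone n).measurableSet
  set G := {t : Fin n → ℝ | Monotone t}.indicator F with hG
  have hGm : Measurable G := hF.indicator hm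
  calc ∫⁻ t, F t ∂(cubeMeasure (Fin n))
      ≤ ∫⁻ t, ∑ σ : Equiv.Perm (Fin n), G (t ∘ σ) ∂(cubeMeasure (Fin n)) := by
        refine lintegral_mono fun t => ?_
        refine le_trans ?_ (Finset.single_le_sum (f := fun σ : Equiv.Perm (Fin n) => G (t ∘ σ))
          (fun _ _ => zero_le) (Finset.mem_univ (Tuple.sort t)))
        rw [hG, Set.indicator_of_mem (show t ∘ Tuple.sort t ∈ _ from Tuple.monotone_sort t), hs]
    _ = ∑ σ : Equiv.Perm (Fin n), ∫⁻ t, G (t ∘ σ) ∂(cubeMeasure (Fin n)) :=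
        lintegral_finsetSum _ fun σ _ => hGm.comp (by fun_prop)
    _ = ∑ _σ : Equiv.Perm (Fin n), ∫⁻ t, G t ∂(cubeMeasure (Fin n)) := by
        refine Finset.sum_congr rfl fun σ _ => ?_
        exact (lintegral_pi_reindex unitMeasure σ.symm G).symm
    _ = _ := by
        rw [Finset.sum_const, Finset.card_univ, Fintype.card_perm, Fintype.card_fin, nsmul_eq_mul,
          hG, lintegral_indicator hm]

/-- Finite sums of powers are dense in `L^q` among the bounded symmetric functions. -/
lemma exists_lintegral_sub_tensorSum_rpow_le {H : ℝ} (hH : 1 / 2 < H) {n : ℕ}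
    {f : (Fin n → ℝ) → ℝ} (hf : Measurable f) {M : ℝ} (hM : ∀ t, |f t| ≤ M)
    (hs : ∀ t (σ : Equiv.Perm (Fin n)), f (t ∘ σ) = f t) {q : ℝ} (hq : 1 < q) {ε : ℝ} (hε : 0 < ε) :
    ∃ c : AbsH H →₀ ℝ, ∫⁻ t, ‖f t - tensorSum n c t‖ₑ ^ q ∂(cubeMeasure (Fin n)) ≤
      n ! * ENNReal.ofReal ε ^ q := by
  set ν := (cubeMeasure (Fin n)).restrict {t | Monotone t} with hν
  have hq1 : 1 ≤ ENNReal.ofReal q := ENNReal.one_le_ofReal.2 hq.le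
  have hfM : MemLp f (ENNReal.ofReal q) ν :=
    MemLp.of_bound hf.aestronglyMeasurable M (.of_forall hM)
  obtain ⟨g, hg, -⟩ := hfM.exists_boundedContinuous_eLpNorm_sub_le ENNReal.ofReal_ne_top
    (ε := ENNReal.ofReal (ε / 2)) (by simpa using hε)
  obtain ⟨c, hc⟩ := exists_tensorSum_near hH n g.continuous (half_pos hε)
  refine ⟨c, ?_⟩
  have hcm := measurable_tensorSum n c
  have hgc : eLpNorm (fun t => g t - tensorSum n c t) (ENNReal.ofReal q) ν ≤
      ENNReal.ofReal (ε / 2) := by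
    have h1 : ∀ᵐ t ∂ν, ‖g t - tensorSum n c t‖ ≤ ε / 2 := by
      have h2 : ∀ᵐ t ∂(cubeMeasure (Fin n)), t ∈ unitCube n := by
        rw [← restrict_unitCube]
        exact ae_restrict_mem measurableSet_Icc
      filter_upwards [ae_restrict_of_ae h2, ae_restrict_mem (isClosed_monotone n).measurableSet]
        with t ht ht'
      exact (hc t ⟨ht, ht'⟩).le
    refine (eLpNorm_le_of_ae_bound h1).trans (mul_le_of_le_one_left zero_le ?_)
    refine ENNReal.rpow_le_one ?_ (by positivity)
    exact (Measure.restrict_apply_univ _).trans_le prob_le_one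
  have hfc : eLpNorm (fun t => f t - tensorSum n c t) (ENNReal.ofReal q) ν ≤ ENNReal.ofReal ε := by
    have h1 : (fun t => f t - tensorSum n c t) = (f - g) + fun t => g t - tensorSum n c t := by
      ext t
      simp
    rw [h1, ← add_halves ε, ENNReal.ofReal_add (by positivity) (by positivity)]
    refine (eLpNorm_add_le (hf.sub g.continuous.measurable).aestronglyMeasurable
      (g.continuous.measurable.sub hcm).aestronglyMeasurable hq1).trans (add_le_add hg hgc)
  have hq0 : 0 < q := by linarith
  refine (lintegral_le_factorial_mul_lintegral_monotone
    ((hf.sub hcm).enorm.pow_const q)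
    fun t σ => by simp only [Pi.sub_apply, hs, tensorSum_comp_perm]).trans ?_
  gcongr
  rw [eLpNorm_eq_lintegral_rpow_enorm_toReal (by positivity) ENNReal.ofReal_ne_top,
    ENNReal.toReal_ofReal hq0.le, one_div, ENNReal.rpow_inv_le_iff hq0] at hfc
  exact hfc

/-- Finite sums of powers are dense among the symmetric functions of finite norm. -/
lemma exists_stratNormSq_sub_tensorSum_lt {H : ℝ} (hH : H ∈ Set.Ioo (1 / 2 : ℝ) 1) {n : ℕ}
    {f : (Fin n → ℝ) → ℝ} (hf : Measurable f)
    (hs : ∀ t (σ : Equiv.Perm (Fin n)), f (t ∘ σ) = f t) (hfin : stratNormSq H n f < ∞)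
    {ε : ℝ≥0∞} (hε : 0 < ε) :
    ∃ c : AbsH H →₀ ℝ, stratNormSq H n (fun t => f t - tensorSum n c t) < ε := by
  -- Half of `ε` is reserved for the truncation error and half for the approximation of the
  -- truncated function, each doubled by the quasi-triangle inequality.
  have hlim := ENNReal.Tendsto.const_mul (a := 2) (tendsto_stratNormSq_sub_truncate hf hfin)
    (Or.inr (by simp))
  rw [mul_zero] at hlim
  obtain ⟨M, hM⟩ := (hlim.eventually_lt_const (ENNReal.half_pos hε.ne')).exists
  have htm : Measurable (truncate M f) := measurable_truncate (M : ℝ) hf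
  obtain ⟨q, hq, C, hC, hle⟩ := exists_stratNormSq_le_lintegral_rpow hH n
  have hq0 : 0 < q := by linarith
  have hlim2 : Tendsto (fun k : ℕ =>
      2 * (C * ((n ! * ENNReal.ofReal (1 / (k + 1 : ℝ)) ^ q) ^ 2) ^ (1 / q)))
      atTop (𝓝 0) := by
    have h0 : (0 : ℝ≥0∞) = 2 * (C * ((n ! * ENNReal.ofReal 0 ^ q) ^ 2) ^ (1 / q)) := by
      simp [hq0]
    rw [h0]
    refine ENNReal.Tendsto.const_mul (ENNReal.Tendsto.const_mul ?_ (Or.inr hC)) (Or.inr (by simp))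
    refine Tendsto.ennrpow_const _ (ENNReal.Tendsto.pow (ENNReal.Tendsto.const_mul ?_
      (Or.inr (by simp))))
    exact Tendsto.ennrpow_const _ ((ENNReal.continuous_ofReal.tendsto 0).comp
      tendsto_one_div_add_atTop_nhds_zero_nat)
  obtain ⟨k, hk⟩ := (hlim2.eventually_lt_const (ENNReal.half_pos hε.ne')).exists
  obtain ⟨c, hc⟩ := exists_lintegral_sub_tensorSum_rpow_le hH.1 htm
    (abs_truncate_le (Nat.cast_nonneg M) f) (fun t σ => by simp only [truncate, hs]) hq
    (ε := 1 / (k + 1 : ℝ)) (by positivity)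
  have hcm : Measurable fun t => truncate M f t - tensorSum n c t :=
    htm.sub (measurable_tensorSum n c)
  refine ⟨c, (stratNormSq_le_of_enorm_le hH n (hf.sub htm) hcm fun t => ?_).trans_lt ?_⟩
  · rw [← sub_add_sub_cancel (f t) (truncate M f t)]
    exact enorm_add_le _ _
  · rw [← ENNReal.add_halves ε]
    refine ENNReal.add_lt_add hM (lt_of_le_of_lt ?_ hk)
    gcongr
    refine (hle _ hcm).trans ?_
    gcongr

/-! ### Existence, uniqueness and size of the multiple Stratonovich integral -/

lemma stratSum_sub {Ω : Type*} {H : ℝ} (W : AbsH H → Ω → ℝ) (n : ℕ)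
    (c d : AbsH H →₀ ℝ) (ω : Ω) :
    stratSum W n (c - d) ω = stratSum W n c ω - stratSum W n d ω :=
  Finsupp.sum_sub_index fun _ _ _ => sub_mul _ _ _

section Stratonovich

variable {Ω : Type*} [MeasurableSpace Ω] {P : Measure Ω} [IsProbabilityMeasure P] {H : ℝ}
  {W : AbsH H → Ω → ℝ}

lemma memLp_stratSum (hW : IsIsonormal P H W) (n : ℕ) (c : AbsH H →₀ ℝ) :
    MemLp (stratSum W n c) 2 P := by
  rw [memLp_two_iff_integrable_sq (aestronglyMeasurable_stratSum hW n c)]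
  simpa only [sq] using integrable_stratSum_sq hW n c

/-- Two sums close to the same `f` are close to each other, and the moment bound carries this to
`L²`. Existence and uniqueness of the integral both rest on this estimate. -/
lemma eLpNorm_stratSum_sub_le (hH : H ∈ Set.Ioo (1 / 2 : ℝ) 1) (hW : IsIsonormal P H W) {n : ℕ}
    {f : (Fin n → ℝ) → ℝ} (hf : Measurable f) (c d : AbsH H →₀ ℝ) :
    eLpNorm (fun ω => stratSum W n c ω - stratSum W n d ω) 2 P ≤
      (2 * stratNormSq H n (fun t => f t - tensorSum n c t) +
        2 * stratNormSq H n (fun t => f t - tensorSum n d t)) ^ (1 / 2 : ℝ) := by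
  rw [one_div, ENNReal.le_rpow_inv_iff two_pos, ENNReal.rpow_two]
  simp only [← stratSum_sub]
  refine (eLpNorm_stratSum_sq_le hH hW n (c - d)).trans
    (stratNormSq_le_of_enorm_le hH n (hf.sub (measurable_tensorSum n c))
      (hf.sub (measurable_tensorSum n d)) fun t => ?_)
  rw [tensorSum_sub, ← sub_sub_sub_cancel_left _ _ (f t), add_comm]
  exact enorm_sub_le

lemma eLpNorm_stratSum_le (hH : H ∈ Set.Ioo (1 / 2 : ℝ) 1) (hW : IsIsonormal P H W) {n : ℕ}
    {f : (Fin n → ℝ) → ℝ} (hf : Measurable f) (c : AbsH H →₀ ℝ) :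
    eLpNorm (stratSum W n c) 2 P ≤
      (2 * stratNormSq H n (fun t => f t - tensorSum n c t) + 2 * stratNormSq H n f) ^
        (1 / 2 : ℝ) := by
  have h1 : ∀ ω, stratSum W n 0 ω = 0 := fun _ => Finsupp.sum_zero_index
  have h2 : ∀ t, tensorSum n (0 : AbsH H →₀ ℝ) t = 0 := fun _ => Finsupp.sum_zero_index
  simpa only [h1, h2, sub_zero] using eLpNorm_stratSum_sub_le hH hW hf c 0

lemma IsStratonovich.unique (hH : H ∈ Set.Ioo (1 / 2 : ℝ) 1) (hW : IsIsonormal P H W) {n : ℕ}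
    {f : (Fin n → ℝ) → ℝ} (hf : Measurable f) {F G : Lp ℝ 2 P}
    (hF : IsStratonovich P W n f F) (hG : IsStratonovich P W n f G) : F = G := by
  obtain ⟨-, c, hc, hFc⟩ := hF
  obtain ⟨-, d, hd, hGd⟩ := hG
  have hbound : ∀ j, edist F G ≤ eLpNorm (fun ω => F ω - stratSum W n (c j) ω) 2 P +
      (2 * stratNormSq H n (fun t => f t - tensorSum n (c j) t) +
        2 * stratNormSq H n (fun t => f t - tensorSum n (d j) t)) ^ (1 / 2 : ℝ) +
      eLpNorm (fun ω => G ω - stratSum W n (d j) ω) 2 P := by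
    intro j
    have hm := fun c => aestronglyMeasurable_stratSum hW n c
    have hFm : AEStronglyMeasurable (fun ω => F ω - stratSum W n (c j) ω) P :=
      (Lp.aestronglyMeasurable F).sub (hm (c j))
    have hGm : AEStronglyMeasurable (fun ω => G ω - stratSum W n (d j) ω) P :=
      (Lp.aestronglyMeasurable G).sub (hm (d j))
    have hcd : AEStronglyMeasurable (fun ω => stratSum W n (c j) ω - stratSum W n (d j) ω) P :=
      (hm (c j)).sub (hm (d j))
    have h : (F : Ω → ℝ) - G = (fun ω => F ω - stratSum W n (c j) ω) +
        (fun ω => stratSum W n (c j) ω - stratSum W n (d j) ω) -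
          fun ω => G ω - stratSum W n (d j) ω := by
      ext ω
      simp
    rw [Lp.edist_def, h]
    refine (eLpNorm_sub_le (hFm.add hcd) hGm one_le_two).trans (add_le_add_left ?_ _)
    refine (eLpNorm_add_le hFm hcd one_le_two).trans (add_le_add_right ?_ _)
    exact eLpNorm_stratSum_sub_le hH hW hf _ _
  have hlim := (hFc.add (((ENNReal.Tendsto.const_mul (a := 2) hc (Or.inr (by simp))).add
    (ENNReal.Tendsto.const_mul (a := 2) hd (Or.inr (by simp)))).ennrpow_const (1 / 2))).add hGd
  have h0 := ge_of_tendsto' hlim hbound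
  simpa using h0

/-- Choose approximations with error below `1/(j+1)`; their integrals form a Cauchy sequence, whose
limit in `L²` is the integral. -/
lemma exists_isStratonovich (hH : H ∈ Set.Ioo (1 / 2 : ℝ) 1) (hW : IsIsonormal P H W) {n : ℕ}
    {f : (Fin n → ℝ) → ℝ} (hf : Measurable f)
    (hs : ∀ t (σ : Equiv.Perm (Fin n)), f (t ∘ σ) = f t) (hfin : stratNormSq H n f < ∞) :
    ∃ F : Lp ℝ 2 P, IsStratonovich P W n f F := by
  have hinv : Tendsto (fun j : ℕ => ((j + 1 : ℕ) : ℝ≥0∞)⁻¹) atTop (𝓝 0) :=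
    ENNReal.tendsto_inv_nat_nhds_zero.comp (tendsto_add_atTop_nat 1)
  choose c hc using fun j : ℕ => exists_stratNormSq_sub_tensorSum_lt hH hf hs hfin
    (ε := ((j + 1 : ℕ) : ℝ≥0∞)⁻¹) (by simp)
  have hcauchy : CauchySeq fun j => (memLp_stratSum hW n (c j)).toLp := by
    rw [EMetric.cauchySeq_iff_le_tendsto_0]
    refine ⟨fun j => (2 * ((j + 1 : ℕ) : ℝ≥0∞)⁻¹ + 2 * ((j + 1 : ℕ) : ℝ≥0∞)⁻¹) ^ (1 / 2 : ℝ),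
      fun i j N hi hj => ?_, ?_⟩
    · rw [Lp.edist_toLp_toLp]
      refine (eLpNorm_stratSum_sub_le hH hW hf (c i) (c j)).trans ?_
      beta_reduce
      gcongr
      · exact (hc i).le.trans (ENNReal.inv_le_inv.2 (by gcongr))
      · exact (hc j).le.trans (ENNReal.inv_le_inv.2 (by gcongr))
    · have h2 := ENNReal.Tendsto.const_mul (a := 2) hinv (Or.inr (by simp))
      simpa using (h2.add h2).ennrpow_const (1 / 2)
  obtain ⟨F, hF⟩ := cauchySeq_tendsto_of_complete hcauchy
  refine ⟨F, hf.aemeasurable, c, ?_, ?_⟩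
  · exact tendsto_of_tendsto_of_tendsto_of_le_of_le tendsto_const_nhds hinv
      (fun _ => zero_le) fun j => (hc j).le
  · rw [tendsto_iff_edist_tendsto_0] at hF
    refine hF.congr fun j => ?_
    rw [edist_comm, Lp.edist_def]
    refine eLpNorm_congr_ae ?_
    filter_upwards [(memLp_stratSum hW n (c j)).coeFn_toLp] with ω hω
    rw [Pi.sub_apply, hω]

/-- The norm of the multiple Stratonovich integral. -/
lemma IsStratonovich.enorm_sq_le (hH : H ∈ Set.Ioo (1 / 2 : ℝ) 1) (hW : IsIsonormal P H W) {n : ℕ}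
    {f : (Fin n → ℝ) → ℝ} (hf : Measurable f) {F : Lp ℝ 2 P} (hF : IsStratonovich P W n f F) :
    ‖F‖ₑ ^ 2 ≤ 2 * stratNormSq H n f := by
  obtain ⟨-, c, hc, hFc⟩ := hF
  have hbound : ∀ j, ‖F‖ₑ ≤ eLpNorm (fun ω => F ω - stratSum W n (c j) ω) 2 P +
      (2 * stratNormSq H n (fun t => f t - tensorSum n (c j) t) + 2 * stratNormSq H n f) ^
        (1 / 2 : ℝ) := by
    intro j
    have hm := aestronglyMeasurable_stratSum hW n (c j)
    have hFm : AEStronglyMeasurable (fun ω => F ω - stratSum W n (c j) ω) P :=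
      (Lp.aestronglyMeasurable F).sub hm
    have h : (F : Ω → ℝ) = (fun ω => F ω - stratSum W n (c j) ω) + stratSum W n (c j) := by
      ext ω
      simp
    rw [Lp.enorm_def]
    nth_rw 1 [h]
    refine (eLpNorm_add_le hFm hm one_le_two).trans (add_le_add_right ?_ _)
    exact eLpNorm_stratSum_le hH hW hf _
  have hlim := hFc.add (((ENNReal.Tendsto.const_mul (a := 2) hc (Or.inr (by simp))).add
    (tendsto_const_nhds (x := 2 * stratNormSq H n f))).ennrpow_const (1 / 2))
  have h0 := ge_of_tendsto' hlim hbound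
  rwa [mul_zero, zero_add, zero_add, one_div, ENNReal.le_rpow_inv_iff two_pos,
    ENNReal.rpow_two] at h0

end Stratonovich

/-! ### Summation of the series -/

/-- The base tends to `0` as `m + k` grows, so it is eventually at most `1/2` in absolute value, and
a product of two geometric series dominates. -/
lemma summable_pow_mul_rpow_add (R : ℝ) {ε : ℝ} (hε : 0 < ε) :
    Summable fun mk : ℕ × ℕ =>
      (R * (2 * (mk.1 + mk.2 : ℕ) + 1 : ℝ) ^ (-ε)) ^ (mk.1 + mk.2) := by
  set b : ℕ → ℝ := fun N => R * (2 * N + 1 : ℝ) ^ (-ε) with hb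
  have hlim : Tendsto b atTop (𝓝 0) := by
    rw [← mul_zero R]
    refine Tendsto.const_mul R ((tendsto_rpow_neg_atTop hε).comp ?_)
    exact tendsto_atTop_add_const_right _ _
      (tendsto_natCast_atTop_atTop.const_mul_atTop two_pos)
  have hO : (fun N => b N ^ N) =O[atTop] fun N : ℕ => (1 / 2 : ℝ) ^ N := by
    refine Asymptotics.IsBigO.of_bound 1 ?_
    have habs := hlim.abs
    rw [abs_zero] at habs
    filter_upwards [habs.eventually_le_const (show (0 : ℝ) < 1 / 2 by norm_num)] with N hN
    rw [one_mul, norm_pow, norm_pow, Real.norm_eq_abs, Real.norm_of_nonneg (by norm_num)]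
    gcongr
  obtain ⟨C, -, hC⟩ := Asymptotics.bound_of_isBigO_nat_atTop hO
  have hs := (summable_geometric_two.mul_of_nonneg summable_geometric_two
    (fun _ => by positivity) fun _ => by positivity).mul_left C
  refine hs.of_norm_bounded fun mk => ?_
  refine (hC (x := mk.1 + mk.2) (by positivity)).trans_eq ?_
  rw [Real.norm_of_nonneg (by positivity), pow_add]

/-- The factor `m! k!` in the bound on the norm of `F` cancels the denominator of the coefficient,
leaving a power of order `m + k` times `X`. -/
lemma norm_smul_le_of_enorm_sq_le {E : Type*} [NormedAddCommGroup E] [NormedSpace ℝ E] {F : E}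
    {β h X : ℝ} (hX : 0 ≤ X) {m k : ℕ}
    (hF : ‖F‖ₑ ^ 2 ≤ 2 * ENNReal.ofReal ((m ! * k !) ^ 2 * Real.exp 1 * X ^ 2)) :
    ‖(β ^ m * h ^ k / ((m ! : ℝ) * (k ! : ℝ))) • F‖ ≤
      √(2 * Real.exp 1) * (max |β| |h| ^ (m + k) * X) := by
  have hm : (0 : ℝ) < m ! * k ! := by positivity
  have h1 : ‖F‖ ≤ √(2 * Real.exp 1) * (m ! * k !) * X := by
    refine le_of_sq_le_sq ?_ (by positivity)
    rw [← ofReal_norm, ← ENNReal.ofReal_pow (norm_nonneg _),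
      show (2 : ℝ≥0∞) = ENNReal.ofReal 2 by simp, ← ENNReal.ofReal_mul (by norm_num),
      ENNReal.ofReal_le_ofReal_iff (by positivity)] at hF
    refine hF.trans_eq ?_
    have h := Real.sq_sqrt (show 0 ≤ 2 * Real.exp 1 by positivity)
    linear_combination (-((m ! * k ! : ℝ) ^ 2 * X ^ 2)) * h
  have h2 : |β| ^ m * |h| ^ k ≤ max |β| |h| ^ (m + k) := by
    rw [pow_add]
    gcongr
    · exact le_max_left _ _
    · exact le_max_right _ _
  calc ‖(β ^ m * h ^ k / ((m ! : ℝ) * (k ! : ℝ))) • F‖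
      = |β| ^ m * |h| ^ k / (m ! * k !) * ‖F‖ := by
        rw [norm_smul, Real.norm_eq_abs, abs_div, abs_mul, abs_pow, abs_pow, abs_of_pos hm]
    _ ≤ max |β| |h| ^ (m + k) / (m ! * k !) * (√(2 * Real.exp 1) * (m ! * k !) * X) := by
        gcongr
    _ = _ := by
        field_simp

end Pinning

/-! ### Well-posedness of the integrals and absolute convergence of the double series -/

theorem proposition4p2 {Ω : Type*} [MeasurableSpace Ω] (P : MeasureTheory.Measure Ω)
    [MeasureTheory.IsProbabilityMeasure P]
    (H α : ℝ) (hH : H ∈ Set.Ioo (1 / 2 : ℝ) 1) (hα : 0 < α) (hαH : 3 / 2 < α + H)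
    (L : ℝ → ℝ) (p : PMF ℕ) (hp : Pinning.IsInterArrivalLaw α L p)
    (W : Pinning.AbsH H → Ω → ℝ) (hW : Pinning.IsIsonormal P H W)
    (β h : ℝ) (hβ : 0 < β) :
    (∀ m k : ℕ, ∃! F : MeasureTheory.Lp ℝ 2 P,
      Pinning.IsStratonovich P W m (Pinning.psi α (Pinning.meanInterArrival p) m k) F) ∧
    ∃ Z : MeasureTheory.Lp ℝ 2 P,
      HasSum (fun mk : ℕ × ℕ =>
        (β ^ mk.1 * h ^ mk.2 / ((mk.1.factorial : ℝ) * (mk.2.factorial : ℝ))) •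
          Pinning.stratonovich P W mk.1
            (Pinning.psi α (Pinning.meanInterArrival p) mk.1 mk.2)) Z := by
  set μ := Pinning.meanInterArrival p
  have hex : ∀ m k : ℕ, ∃ F : Lp ℝ 2 P, Pinning.IsStratonovich P W m (Pinning.psi α μ m k) F :=
    fun m k => Pinning.exists_isStratonovich hH hW (Pinning.measurable_psi α μ m k)
      (Pinning.psi_comp_perm α μ m k) (Pinning.stratNormSq_psi_lt_top hH hαH μ m k)
  refine ⟨fun m k => ?_, ?_⟩
  · obtain ⟨F, hF⟩ := hex m k
    exact ⟨F, hF, fun G hG => hG.unique hH hW (Pinning.measurable_psi α μ m k) hF⟩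
  · obtain ⟨B, ε, hB, hε, hle⟩ := Pinning.exists_stratNormSq_psi_le hH hαH μ
    suffices hsum : Summable fun mk : ℕ × ℕ =>
        (β ^ mk.1 * h ^ mk.2 / ((mk.1.factorial : ℝ) * (mk.2.factorial : ℝ))) •
          Pinning.stratonovich P W mk.1 (Pinning.psi α μ mk.1 mk.2) from ⟨_, hsum.hasSum⟩
    -- Absolute convergence in the complete space `L²` yields unconditional convergence. The factor
    -- `max |β| |h|` is absorbed into the geometric constant, against which `(2(m+k)+1)^(-ε)` always
    -- wins.
    refine ((Pinning.summable_pow_mul_rpow_add (max |β| |h| * B) hε).mul_left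
      √(2 * Real.exp 1)).of_norm_bounded fun mk => ?_
    obtain ⟨m, k⟩ := mk
    have hF : Pinning.IsStratonovich P W m (Pinning.psi α μ m k)
        (Pinning.stratonovich P W m (Pinning.psi α μ m k)) := by
      rw [Pinning.stratonovich, dif_pos (hex m k)]
      exact (hex m k).choose_spec
    refine (Pinning.norm_smul_le_of_enorm_sq_le
      (X := (B * (2 * (m + k : ℕ) + 1 : ℝ) ^ (-ε)) ^ (m + k)) (by positivity)
      ((hF.enorm_sq_le hH hW (Pinning.measurable_psi α μ m k)).trans ?_)).trans_eq ?_
    · gcongr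
      exact hle m k
    · rw [← mul_pow, mul_assoc]
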